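/- Let $m\ge 5$ be an odd integer. Then there exists a planar $J(6m,m)$ graph. Here a $J(n,m)$ graph (a complete $m$-pire graph on $n$ empires) is a triple $(G,A,h)$ consisting of a finite connected simple graph $G$, a set $A$ of exactly $n$ empires, and a surjective map $h\colon V(G)\to A$ such that $|h^{-1}(\alpha)|\le m$ for every $\alpha\in A$, and such that for any two distinct empires $\alpha,\beta\in A$ there are adjacent vertices $v,w$ of $G$ with $h(v)=\alpha$ and $h(w)=\beta$. It is called planar if $G$ can be drawn in the plane without crossings. -/

import Mathlib

/-- A drawing of the simple graph `G` in the plane without crossings: distinct vertices are sent to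
distinct points, and every edge is sent to a simple arc (an injective continuous image of `[0, 1]`)
that joins the points of its two ends, contains no vertex point in its interior, and whose interior
meets no other arc. The plane is `ℝ × ℝ`; only its topology is used. -/
structure PlaneDrawing {V : Type*} (G : SimpleGraph V) where
  /-- the points that represent the vertices -/
  point : V → ℝ × ℝ
  /-- the arcs that represent the edges -/
  arc : G.edgeSet → C(unitInterval, ℝ × ℝ)
  point_injective : Function.Injective point
  arc_injective : ∀ e, Function.Injective (arc e)
  arc_ends : ∀ e, s(arc e 0, arc e 1) = Sym2.map point (e : Sym2 V)
  arc_avoids_points : ∀ e, ∀ t ∈ Set.Ioo (0 : unitInterval) 1, ∀ v, arc e t ≠ point v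
  arc_avoids_arcs : ∀ e e', e ≠ e' → ∀ t ∈ Set.Ioo (0 : unitInterval) 1, ∀ t', arc e t ≠ arc e' t'

/-- A graph is planar if it can be drawn in the plane without crossings. -/
def IsPlanar {V : Type*} (G : SimpleGraph V) : Prop :=
  Nonempty (PlaneDrawing G)

/-- `(G, A, h)` is an `m`-pire graph: `G` is a finite connected simple graph, `A` is the set of
empires, `h` sends every vertex to the empire it belongs to, and every empire consists of at least
one and at most `m` vertices. -/
structure IsMPireGraph {V A : Type*} (m : ℕ) (G : SimpleGraph V) (h : V → A) : Prop where
  finite : Finite V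
  connected : G.Connected
  surjective : Function.Surjective h
  card_le : ∀ α : A, (h ⁻¹' {α}).ncard ≤ m

/-- `(G, A, h)` is a `J(n, m)` graph (a complete `m`-pire graph on `n` empires): an `m`-pire graph
with exactly `n` empires, any two of which are neighbouring. -/
structure IsJGraph {V A : Type*} (n m : ℕ) (G : SimpleGraph V) (h : V → A) : Prop
    extends IsMPireGraph m G h where
  card_empires : Nat.card A = n
  neighbouring : ∀ α β : A, α ≠ β → ∃ v w : V, G.Adj v w ∧ h v = α ∧ h w = β

/-! Write m = 2h+1 and identify the empires with the residues modulo 6m. The 6m² vertices lie on a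
circle, cut into 3m consecutive blocks of 2m places, and all edges are drawn on two pages, inside
and outside the circle; parabolic arcs turn such a book embedding into a plane drawing.

Block j contains two poles, labelled 2j+1 and 2j+2, and 4h further vertices, its contents, labelled
2j+6d and 2j+6d-1 with d nonzero modulo m. The poles are joined to each other and to the contents.
Split the pairs {2n-1, 2n} into three classes by n modulo 3: the poles of block j lie in class j+1
and its contents in class j. Hence the pole-content edges realise all pairs of labels from different
classes, except some of difference 1, 2 or 3, which come from edges between poles and from the step
between two blocks.

Pairs inside a class come from consecutive contents. The arrangement of block j depends only on j
modulo 3, and passing from j to j+3 shifts all labels by 6. So it suffices that in each of the three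
types of block every difference occurs once (`FanBlock.Complete`): h differences between labels
2j+6d, h between labels 2j+6d-1, and 2h mixed ones, 4h in all. The supply is exactly 4h: the 4h-1
consecutive pairs lose the one interrupted by the second pole, but the preceding pole meets the
first content, and each block gets one extra edge. Zigzag sequences (`evenSeq`, `oddSeq`) waste no
pair.

Each label occurs on one pole and on 2h contents, so every empire has exactly m vertices. -/

/-! ### Book embeddings give plane drawings -/

/-- Two parabolic arcs over the intervals `[a, b]` and `[c, d]` that do not interleave meet only
if the intervals coincide. -/
theorem parabolas_coincide {a b c d x : ℝ} (hax : a < x) (hxb : x < b) (hcx : c ≤ x) (hxd : x ≤ d)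
    (h1 : a < c → c < b → b < d → False) (h2 : c < a → a < d → d < b → False)
    (h : (x - a) * (b - x) = (x - c) * (d - x)) : a = c ∧ b = d := by
  have hpos : 0 < (x - a) * (b - x) := mul_pos (by linarith) (by linarith)
  have hcx' : c < x := by
    rcases hcx.lt_or_eq with h' | h'
    · exact h'
    · subst h'; simp at h; rcases h with h | h <;> linarith
  have hxd' : x < d := by
    rcases hxd.lt_or_eq with h' | h'
    · exact h'
    · subst h'; simp at h; rcases h with h | h <;> linarith
  -- If the left ends differ, non-interleaving nests the intervals. The distances from `x` to the
  -- ends of the inner one are then no larger, and one is strictly smaller, so the products differ.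
  rcases lt_trichotomy a c with hac | hac | hac
  · exfalso
    have hdb : d ≤ b := not_lt.1 fun hbd => h1 hac (by linarith) hbd
    have : (x - c) * (d - x) < (x - a) * (b - x) :=
      mul_lt_mul (by linarith) (by linarith) (by linarith) (by linarith)
    linarith
  · subst hac
    refine ⟨rfl, ?_⟩
    have := mul_left_cancel₀ (by linarith : x - a ≠ 0) h
    linarith
  · exfalso
    have hdb : b ≤ d := not_lt.1 fun hbd => h2 hac (by linarith) hbd
    have : (x - a) * (b - x) < (x - c) * (d - x) :=
      mul_lt_mul (by linarith) (by linarith) (by linarith) (by linarith)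
    linarith

/-- The parabolic arc over `[a, b]`, on the side of the axis given by the sign of `σ`. -/
def parabolicArc (a b σ : ℝ) : C(unitInterval, ℝ × ℝ) where
  toFun t := (a + t * (b - a), σ * ((t * (b - a)) * ((1 - t) * (b - a))))
  continuous_toFun := by fun_prop

/-- A graph with a two-page book embedding is planar: the vertices lie on an axis, and every edge is
assigned to one of two pages so that no two edges in the same page interleave. -/
theorem isPlanar_of_book {V : Type*} (G : SimpleGraph V) (pos : V → ℝ)
    (hpos : Function.Injective pos) (U D : V → V → Prop)
    (hadj : ∀ u v, G.Adj u v → pos u < pos v → U u v ∨ D u v)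
    (hU : ∀ a b c d, U a b → U c d → pos a < pos c → pos c < pos b → pos b < pos d → False)
    (hD : ∀ a b c d, D a b → D c d → pos a < pos c → pos c < pos b → pos b < pos d → False) :
    IsPlanar G := by
  have key : ∀ e : G.edgeSet, ∃ a b : V, ∃ σ : ℝ, (e : Sym2 V) = s(a, b) ∧ pos a < pos b ∧
      (σ = 1 ∧ U a b ∨ σ = -1 ∧ D a b) := by
    rintro ⟨e, he⟩
    induction e with | _ u v =>
    have huv : G.Adj u v := he
    rcases lt_trichotomy (pos u) (pos v) with h | h | h
    · rcases hadj u v huv h with h' | h'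
      · exact ⟨u, v, 1, rfl, h, Or.inl ⟨rfl, h'⟩⟩
      · exact ⟨u, v, -1, rfl, h, Or.inr ⟨rfl, h'⟩⟩
    · exact absurd (hpos h) huv.ne
    · rcases hadj v u huv.symm h with h' | h'
      · exact ⟨v, u, 1, Sym2.eq_swap, h, Or.inl ⟨rfl, h'⟩⟩
      · exact ⟨v, u, -1, Sym2.eq_swap, h, Or.inr ⟨rfl, h'⟩⟩
  choose a b σ hab hlt hσ using key
  have hσ0 : ∀ e, σ e ≠ 0 := fun e => by rcases hσ e with h | h <;> rw [h.1] <;> norm_num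
  refine ⟨⟨fun v => (pos v, 0), fun e => parabolicArc (pos (a e)) (pos (b e)) (σ e), ?_, ?_, ?_, ?_,
    ?_⟩⟩
  · intro u v h
    exact hpos (congrArg Prod.fst h)
  · intro e t t' h
    have h1 : pos (a e) + (t : ℝ) * (pos (b e) - pos (a e)) =
      pos (a e) + (t' : ℝ) * (pos (b e) - pos (a e)) := congrArg Prod.fst h
    have h2 := hlt e
    exact Subtype.ext (mul_right_cancel₀ (by linarith : pos (b e) - pos (a e) ≠ 0)
      (by linarith))
  · intro e
    rw [hab e]
    simp [parabolicArc]
  · intro e t ht v h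
    have h2 : σ e * (((t : ℝ) * (pos (b e) - pos (a e))) *
      ((1 - (t : ℝ)) * (pos (b e) - pos (a e)))) = 0 := congrArg Prod.snd h
    have h3 := hlt e
    have ht0 : (0 : ℝ) < t := ht.1
    have ht1 : (t : ℝ) < 1 := ht.2
    have : 0 < ((t : ℝ) * (pos (b e) - pos (a e))) * ((1 - (t : ℝ)) * (pos (b e) - pos (a e))) :=
      mul_pos (mul_pos ht0 (by linarith)) (mul_pos (by linarith) (by linarith))
    rcases mul_eq_zero.1 h2 with h | h
    · exact hσ0 e h
    · linarith
  · intro e e' hne t ht t' h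
    have h1 : pos (a e) + (t : ℝ) * (pos (b e) - pos (a e)) =
      pos (a e') + (t' : ℝ) * (pos (b e') - pos (a e')) := congrArg Prod.fst h
    have h2 : σ e * (((t : ℝ) * (pos (b e) - pos (a e))) *
      ((1 - (t : ℝ)) * (pos (b e) - pos (a e)))) = σ e' * (((t' : ℝ) * (pos (b e') - pos (a e'))) *
      ((1 - (t' : ℝ)) * (pos (b e') - pos (a e')))) := congrArg Prod.snd h
    have ht0 : (0 : ℝ) < t := ht.1
    have ht1 : (t : ℝ) < 1 := ht.2
    have ht0' : (0 : ℝ) ≤ t' := t'.2.1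
    have ht1' : (t' : ℝ) ≤ 1 := t'.2.2
    have hl := sub_pos.2 (hlt e)
    have hl' := sub_pos.2 (hlt e')
    have p1 := mul_pos ht0 hl
    have p2 := mul_pos (sub_pos.2 ht1) hl
    have p3 := mul_nonneg ht0' hl'.le
    have p4 := mul_nonneg (sub_nonneg.2 ht1') hl'.le
    have q1 := mul_pos p1 p2
    have q2 := mul_nonneg p3 p4
    have fin : (∃ P : V → V → Prop, P (a e) (b e) ∧ P (a e') (b e') ∧
        ∀ a b c d, P a b → P c d → pos a < pos c → pos c < pos b → pos b < pos d → False) →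
        σ e = σ e' → False := by
      rintro ⟨P, hP, hP', hP3⟩ hs
      rw [← hs] at h2
      have h2' := mul_left_cancel₀ (hσ0 e) h2
      have := parabolas_coincide (a := pos (a e)) (b := pos (b e)) (c := pos (a e'))
        (d := pos (b e')) (x := pos (a e) + (t : ℝ) * (pos (b e) - pos (a e)))
        (by linarith) (by linarith) (by linarith) (by linarith) (hP3 _ _ _ _ hP hP')
        (hP3 _ _ _ _ hP' hP)
        (by
          have e1 : pos (a e) + (t : ℝ) * (pos (b e) - pos (a e)) - pos (a e) =
            (t : ℝ) * (pos (b e) - pos (a e)) := by ring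
          have e2 : pos (b e) - (pos (a e) + (t : ℝ) * (pos (b e) - pos (a e))) =
            (1 - (t : ℝ)) * (pos (b e) - pos (a e)) := by ring
          rw [e1, e2, h2', h1]; ring)
      apply hne
      apply Subtype.ext
      rw [hab e, hab e', hpos this.1, hpos this.2]
    rcases hσ e with ⟨s1, hP⟩ | ⟨s1, hP⟩ <;> rcases hσ e' with ⟨s2, hP'⟩ | ⟨s2, hP'⟩
    · exact fin ⟨U, hP, hP', hU⟩ (s1.trans s2.symm)
    -- On opposite pages the heights have opposite signs, and the first is nonzero because `t` is
    -- interior.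
    · rw [s1, s2] at h2; linarith
    · rw [s1, s2] at h2; linarith
    · exact fin ⟨D, hP, hP', hD⟩ (s1.trans s2.symm)

/-- A two-page book embedding around a circle of `n` points, described by its lift to `ℤ`. -/
theorem isPlanar_of_periodic_book {n : ℕ} (G : SimpleGraph (Fin n)) (U D : ℤ → ℤ → Prop)
    (hUper : ∀ a b, U a b → ∀ k : ℤ, U (a + k * n) (b + k * n))
    (hDper : ∀ a b, D a b → ∀ k : ℤ, D (a + k * n) (b + k * n))
    (hUlt : ∀ a b, U a b → a < b ∧ b < a + n) (hDlt : ∀ a b, D a b → a < b ∧ b < a + n)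
    (hU : ∀ a b c d, U a b → U c d → a < c → c < b → b < d → False)
    (hD : ∀ a b c d, D a b → D c d → a < c → c < b → b < d → False)
    (hadj : ∀ u v, G.Adj u v → ∃ a b : ℤ, (U a b ∨ D a b) ∧
      (a ≡ u [ZMOD n] ∧ b ≡ v [ZMOD n] ∨ a ≡ v [ZMOD n] ∧ b ≡ u [ZMOD n])) :
    IsPlanar G := by
  -- A chord shorter than `n` is determined by the residues of its ends and its left end, so it can
  -- be moved to any prescribed representatives at distance less than `n`.
  have lift : ∀ P : ℤ → ℤ → Prop, (∀ a b, P a b → ∀ k : ℤ, P (a + k * n) (b + k * n)) →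
      (∀ a b, P a b → a < b ∧ b < a + n) → ∀ a b : ℤ, P a b → ∀ u w : ℤ, a ≡ u [ZMOD n] →
      b ≡ w [ZMOD n] → u < w → w < u + n → P u w := by
    intro P hper hlt a b hP u w hu hw h1 h2
    obtain ⟨k, hk⟩ := hu.dvd
    obtain ⟨l, hl⟩ := hw.dvd
    have h3 := hper a b hP k
    have h4 := hlt _ _ h3
    have e1 : a + k * n = u := by linarith
    rw [e1] at h3 h4
    have e2 : b + k * n = w := by
      have e3 : w - (b + k * n) = n * (l - k) := by rw [mul_sub, ← hl]; ring
      have h5 : (n : ℤ) * (l - k) < n * 1 := by linarith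
      have h6 : (n : ℤ) * (-1) < n * (l - k) := by linarith
      have hn : (0 : ℤ) ≤ n := by positivity
      have h7 := lt_of_mul_lt_mul_left h5 hn
      have h8 := lt_of_mul_lt_mul_left h6 hn
      have : l - k = 0 := by omega
      rw [this] at e3
      linarith
    rwa [e2] at h3
  -- When the circle is cut open, a chord over `u < v` may be the arc from `v` around to `u + n`. In
  -- each combination a suitable pair of translates interleaves in the lift.
  have page : ∀ P : ℤ → ℤ → Prop, (∀ a b, P a b → ∀ k : ℤ, P (a + k * n) (b + k * n)) →
      (∀ a b c d, P a b → P c d → a < c → c < b → b < d → False) →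
      ∀ a b c d : Fin n, (P a b ∨ P b (a + n)) → (P c d ∨ P d (c + n)) →
        (((a : ℕ) : ℤ) : ℝ) < ((c : ℕ) : ℤ) → (((c : ℕ) : ℤ) : ℝ) < ((b : ℕ) : ℤ) →
        (((b : ℕ) : ℤ) : ℝ) < ((d : ℕ) : ℤ) → False := by
    intro P hper hP a b c d h1 h2 h3 h4 h5
    rw [Int.cast_lt] at h3 h4 h5
    have ha := a.2
    have hb := b.2
    have hc := c.2
    have hd := d.2
    rcases h1 with h1 | h1 <;> rcases h2 with h2 | h2
    · exact hP _ _ _ _ h1 h2 h3 h4 h5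
    · have := hper _ _ h2 (-1)
      refine hP _ _ _ _ this h1 ?_ ?_ ?_ <;> omega
    · refine hP _ _ _ _ h2 h1 ?_ ?_ ?_ <;> omega
    · refine hP _ _ _ _ h1 h2 ?_ ?_ ?_ <;> omega
  refine isPlanar_of_book G (fun v => (((v : ℕ) : ℤ) : ℝ)) ?_ (fun u v => U u v ∨ U v (u + n))
    (fun u v => D u v ∨ D v (u + n)) ?_ (page U hUper hU) (page D hDper hD)
  · intro u v h
    apply Fin.ext
    simpa using h
  · intro u v huv hlt
    rw [Int.cast_lt] at hlt
    have hu := u.2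
    have hv := v.2
    obtain ⟨a, b, hab, h⟩ := hadj u v huv
    have hmod : b ≡ u [ZMOD n] → b ≡ u + n [ZMOD n] := fun h => h.trans (by simp [Int.ModEq])
    rcases h with ⟨h1, h2⟩ | ⟨h1, h2⟩ <;> rcases hab with hab | hab
    · exact Or.inl (Or.inl (lift U hUper hUlt a b hab _ _ h1 h2 hlt (by omega)))
    · exact Or.inr (Or.inl (lift D hDper hDlt a b hab _ _ h1 h2 hlt (by omega)))
    · exact Or.inl (Or.inr (lift U hUper hUlt a b hab _ _ h1 (hmod h2) (by omega) (by omega)))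
    · exact Or.inr (Or.inr (lift D hDper hDlt a b hab _ _ h1 (hmod h2) (by omega) (by omega)))

/-! ### Fan blocks -/

/-- The contents of the fan between two poles. With `m = 2 * h + 1`, the integers `6 * d` and
`6 * d - 1` (modulo `6 * m`) are the labels of two types of vertices. The sequence `s` has `4 * h`
terms, in which every label of the two types other than `0` and `-1` occurs; the terms before the
index `cut` lie on one side of the edge between the poles, the others lie on the other side. -/
structure FanBlock (h : ℕ) where
  /-- the labels of the vertices of the fan -/
  s : ℕ → ℤ
  /-- the number of vertices on the first side -/
  cut : ℕ
  cut_pos : 1 ≤ cut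
  cut_lt : cut < 4 * h
  last : s (4 * h - 1) = 6
  mem_even : ∀ d : ℤ, 1 ≤ d → d ≤ 2 * h →
    ∃ p < 4 * h, s p = 6 * d ∨ s p = 6 * d - (12 * h + 6)
  mem_odd : ∀ d : ℤ, 1 ≤ d → d ≤ 2 * h →
    ∃ p < 4 * h, s p = 6 * d - 1 ∨ s p = 6 * d - 1 - (12 * h + 6)
  /-- one additional neighbouring pair of labels -/
  extra : ℤ × ℤ

namespace FanBlock

/-- Pairs of labels that become neighbours: consecutive terms on the same side, the first term and
the label `0`, and the additional pair. -/
def Linked {h : ℕ} (B : FanBlock h) (a b : ℤ) : Prop :=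
  (∃ p, p + 1 < 4 * h ∧ p + 1 ≠ B.cut ∧ B.s p = a ∧ B.s (p + 1) = b) ∨ (a = 0 ∧ b = B.s 0) ∨
    (a, b) = B.extra

/-- Every difference of two labels of the two types in the fan is the difference of a linked
pair. -/
structure Complete {h : ℕ} (B : FanBlock h) : Prop where
  even : ∀ d : ℤ, 1 ≤ d → d ≤ h → ∃ a b, (B.Linked a b ∨ B.Linked b a) ∧ a % 6 = 0 ∧
    (b - a = 6 * d ∨ b - a = 6 * d - (12 * h + 6))
  odd : ∀ d : ℤ, 1 ≤ d → d ≤ h → ∃ a b, (B.Linked a b ∨ B.Linked b a) ∧ a % 6 = 5 ∧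
    (b - a = 6 * d ∨ b - a = 6 * d - (12 * h + 6))
  mixed : ∀ d : ℤ, 1 ≤ d → d ≤ 2 * h → ∃ a b, (B.Linked a b ∨ B.Linked b a) ∧ a % 6 = 0 ∧
    (b - a = 6 * d - 1 ∨ b - a = 6 * d - 1 - (12 * h + 6))

/-- The labels along the axis: the two poles `1` and `2` and the terms of the fan. -/
def offset {h : ℕ} (B : FanBlock h) (i : ℕ) : ℤ :=
  if i = 0 then 1 else if i ≤ B.cut then B.s (i - 1) else if i = B.cut + 1 then 2 else B.s (i - 2)

/-- The place of a term of the fan on the axis. -/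
def place {h : ℕ} (B : FanBlock h) (p : ℕ) : ℕ := if p < B.cut then p + 1 else p + 2

theorem offset_place {h : ℕ} (B : FanBlock h) (p : ℕ) : B.offset (B.place p) = B.s p := by
  unfold offset place
  split_ifs <;> first | omega | rfl | simp_all

theorem offset_zero {h : ℕ} (B : FanBlock h) : B.offset 0 = 1 := by simp [offset]

theorem offset_cut {h : ℕ} (B : FanBlock h) : B.offset (B.cut + 1) = 2 := by simp [offset]

end FanBlock

/-! ### Fan systems and their two pages -/

/-- Three fan blocks that together yield a complete graph of empires. In the second block the
vertex at the index `flip` with label `5` is bypassed by an edge between its neighbours. -/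
structure FanSystem (h : ℕ) where
  /-- the blocks, indexed modulo `3` -/
  block : ℤ → FanBlock h
  complete : ∀ g, (block g).Complete
  extra_zero : (block 0).extra = (0, 6)
  extra_two : (block 2).extra = (-1, 5)
  /-- the index of the bypassed vertex -/
  flip : ℕ
  flip_pos : 1 ≤ flip
  flip_lt : flip + 1 < 4 * h
  flip_label : (block 1).s flip = 5
  flip_ne : flip ≠ (block 1).cut
  flip_succ_ne : flip + 1 ≠ (block 1).cut
  extra_one : (block 1).extra = ((block 1).s (flip - 1), (block 1).s (flip + 1))

namespace FanSystem

variable {h : ℕ} (S : FanSystem h)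

/-- The place of the second pole of a block. -/
def pole (j : ℤ) : ℤ := (S.block (j % 3)).cut + 1

theorem pole_pos (j : ℤ) : 2 ≤ S.pole j := by
  have := (S.block (j % 3)).cut_pos
  unfold pole
  omega

theorem pole_lt (j : ℤ) : S.pole j < 4 * h + 1 := by
  have := (S.block (j % 3)).cut_lt
  unfold pole
  omega

theorem pole_congr {i j : ℤ} (hij : i % 3 = j % 3) : S.pole i = S.pole j := by
  rw [pole, pole, hij]

/-- The place of the bypassed vertex. -/
def flipPlace : ℤ := (S.block 1).place S.flip

theorem flipPlace_pos : 2 ≤ S.flipPlace := by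
  have := S.flip_pos
  unfold flipPlace FanBlock.place
  split_ifs <;> omega

theorem flipPlace_lt : S.flipPlace + 1 < 4 * h + 2 := by
  have := S.flip_lt
  unfold flipPlace FanBlock.place
  split_ifs <;> omega

/-- The edges below the axis. -/
inductive Lower : ℤ → ℤ → Prop
  | step (p : ℤ) : Lower p (p + 1)
  | spoke (j i : ℤ) (h0 : 0 < i) (h1 : i < 4 * h + 2) (h2 : ¬(j % 3 = 1 ∧ i = S.flipPlace)) :
      Lower (j * (4 * h + 2)) (j * (4 * h + 2) + i)
  | bypass (j : ℤ) (hj : j % 3 = 1) :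
      Lower (j * (4 * h + 2) + S.flipPlace - 1) (j * (4 * h + 2) + S.flipPlace + 1)
  | next (j : ℤ) : Lower (j * (4 * h + 2)) ((j + 1) * (4 * h + 2))
  -- Labels `2j+1` and `2j+5`: this replaces the spoke given up to make room for the bypass.
  | two (j : ℤ) (hj : j % 3 = 1) : Lower (j * (4 * h + 2)) ((j + 2) * (4 * h + 2))
  -- This is the extra pair `(-1, 5)` of block `j + 1`, which has type 2.
  | three (j : ℤ) (hj : j % 3 = 1) : Lower (j * (4 * h + 2)) ((j + 3) * (4 * h + 2))

/-- The edges above the axis. -/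
inductive Upper : ℤ → ℤ → Prop
  | right (j i : ℤ) (h0 : S.pole j < i) (h1 : i < 4 * h + 2) :
      Upper (j * (4 * h + 2) + S.pole j) (j * (4 * h + 2) + i)
  | left (j i : ℤ) (h0 : 0 < i) (h1 : i < S.pole j) :
      Upper (j * (4 * h + 2) + i) (j * (4 * h + 2) + S.pole j)
  | next (j i : ℤ) (hi : i = 0 ∨ i = 1 ∨ i = S.pole (j + 1)) :
      Upper (j * (4 * h + 2) + S.pole j) ((j + 1) * (4 * h + 2) + i)
  -- This is the extra pair `(0, 6)` of block `j + 1`, which has type 0.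
  | three (j : ℤ) (hj : j % 3 = 2) :
      Upper (j * (4 * h + 2) + S.pole j) ((j + 3) * (4 * h + 2) + S.pole j)

/-! ### Edges of one page do not interleave -/

theorem mul_block_le (h : ℕ) (k : ℤ) {i j : ℤ} (hij : i + k ≤ j) :
    i * (4 * h + 2) + k * (4 * h + 2) ≤ j * (4 * h + 2) := by
  rw [← add_mul]
  exact mul_le_mul_of_nonneg_right hij (by positivity)

/-- A normal form for the crossing check. A bypass spans a single vertex, so a crossing edge would
have to end there; the last clause excludes this. -/
theorem Lower.eq_or_exists {a b : ℤ} (hab : S.Lower a b) : b = a + 1 ∨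
    (∃ j, j % 3 = 1 ∧ a = j * (4 * h + 2) + S.flipPlace - 1 ∧
      b = j * (4 * h + 2) + S.flipPlace + 1) ∨
    ∃ j, a = j * (4 * h + 2) ∧ a < b ∧ (b ≤ (j + 1) * (4 * h + 2) ∨
      j % 3 = 1 ∧ (b = (j + 2) * (4 * h + 2) ∨ b = (j + 3) * (4 * h + 2))) ∧
      ∀ k, k % 3 = 1 → b ≠ k * (4 * h + 2) + S.flipPlace := by
  have f1 := S.flipPlace_pos
  have f2 := S.flipPlace_lt
  have nomul : ∀ j k : ℤ, j * (4 * h + 2) ≠ k * (4 * h + 2) + S.flipPlace := by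
    intro j k hjk
    rcases le_or_gt j k with hl | hl
    · have := mul_block_le h 0 (i := j) (j := k) (by omega)
      omega
    · have := mul_block_le h 1 (i := k) (j := j) (by omega)
      omega
  cases hab with
  | step p => exact Or.inl rfl
  | spoke j i h0 h1 h2 =>
    refine Or.inr (Or.inr ⟨j, rfl, by omega, Or.inl ?_, ?_⟩)
    · have : (j + 1) * (4 * (h : ℤ) + 2) = j * (4 * h + 2) + (4 * h + 2) := by ring
      omega
    · intro k hk hne
      rcases lt_trichotomy j k with hl | hl | hl
      · have := mul_block_le h 1 (i := j) (j := k) (by omega)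
        omega
      · subst hl
        exact h2 ⟨hk, by omega⟩
      · have := mul_block_le h 1 (i := k) (j := j) (by omega)
        omega
  | bypass j hj => exact Or.inr (Or.inl ⟨j, hj, rfl, rfl⟩)
  | next j =>
    refine Or.inr (Or.inr ⟨j, rfl, ?_, Or.inl le_rfl, fun k _ => nomul _ _⟩)
    have := mul_block_le h 1 (i := j) (j := j + 1) (by omega)
    omega
  | two j hj =>
    refine Or.inr (Or.inr ⟨j, rfl, ?_, Or.inr ⟨hj, Or.inl rfl⟩, fun k _ => nomul _ _⟩)
    have := mul_block_le h 2 (i := j) (j := j + 2) (by omega)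
    omega
  | three j hj =>
    refine Or.inr (Or.inr ⟨j, rfl, ?_, Or.inr ⟨hj, Or.inr rfl⟩, fun k _ => nomul _ _⟩)
    have := mul_block_le h 3 (i := j) (j := j + 3) (by omega)
    omega

/-- Apart from steps and bypasses every edge starts at the start of a block. Those leaving the block
and its successor's start begin only in blocks of type 1, three apart; edges starting strictly below
them reach at most the next block start, hence stay nested. -/
theorem Lower.not_interleave (a b c d : ℤ) (hab : S.Lower a b) (hcd : S.Lower c d)
    (h1 : a < c) (h2 : c < b) (h3 : b < d) : False := by
  have f1 := S.flipPlace_pos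
  have f2 := S.flipPlace_lt
  rcases hab.eq_or_exists with h' | ⟨j, hj, rfl, rfl⟩ | ⟨j, rfl, hlt, hb, hb'⟩
  · omega
  · rcases hcd.eq_or_exists with h' | ⟨k, hk, rfl, rfl⟩ | ⟨k, rfl, hlt', hd, hd'⟩
    · omega
    · rcases lt_trichotomy j k with hl | hl | hl
      · have := mul_block_le h 1 (i := j) (j := k) (by omega)
        omega
      · subst hl
        omega
      · have := mul_block_le h 1 (i := k) (j := j) (by omega)
        omega
    · rcases le_or_gt k j with hl | hl
      · have := mul_block_le h 0 (i := k) (j := j) (by omega)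
        omega
      · have := mul_block_le h 1 (i := j) (j := k) (by omega)
        omega
  · rcases hcd.eq_or_exists with h' | ⟨k, hk, rfl, rfl⟩ | ⟨k, rfl, hlt', hd, hd'⟩
    · omega
    · exact hb' k hk (by omega)
    · have hjk : j < k := by
        by_contra hc
        have := mul_block_le h 0 (i := k) (j := j) (by omega)
        omega
      have e1 : (k + 1) * (4 * (h : ℤ) + 2) = k * (4 * h + 2) + (4 * h + 2) := by ring
      rcases hb with hb | ⟨hj, hb | hb⟩
      · have := mul_block_le h 0 (i := j + 1) (j := k) (by omega)
        omega
      · subst hb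
        have hk2 : k < j + 2 := by
          by_contra hc
          have := mul_block_le h 0 (i := j + 2) (j := k) (by omega)
          omega
        have := mul_block_le h 0 (i := k + 1) (j := j + 2) (by omega)
        omega
      · subst hb
        have hk2 : k < j + 3 := by
          by_contra hc
          have := mul_block_le h 0 (i := j + 3) (j := k) (by omega)
          omega
        have := mul_block_le h 0 (i := k + 1) (j := j + 3) (by omega)
        omega

/-- Every edge has a second pole as an end. Short edges to the right reach at most the next second
pole, edges to the left stay in their block, and the long arcs, of span three blocks, start at
blocks of type 2 and so only touch one another. -/
theorem Upper.not_interleave (a b c d : ℤ) (hab : S.Upper a b) (hcd : S.Upper c d)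
    (h1 : a < c) (h2 : c < b) (h3 : b < d) : False := by
  have mono : ∀ i j, i < j → i * (4 * h + 2) + S.pole i < j * (4 * h + 2) := by
    intro i j hij
    have := mul_block_le h 1 (i := i) (j := j) (by omega)
    have := S.pole_lt i
    omega
  have form : ∀ a b, S.Upper a b → (∃ j, a = j * (4 * h + 2) + S.pole j ∧ a < b ∧
      (b ≤ (j + 1) * (4 * h + 2) + 1 ∨ b = (j + 1) * (4 * h + 2) + S.pole (j + 1))) ∨
      (∃ j, j * (4 * h + 2) < a ∧ b = j * (4 * h + 2) + S.pole j) ∨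
      ∃ j, j % 3 = 2 ∧ a = j * (4 * h + 2) + S.pole j ∧
        b = (j + 3) * (4 * h + 2) + S.pole (j + 3) := by
    intro a b hab
    cases hab with
    | right j i h0 h1 =>
      have : (j + 1) * (4 * (h : ℤ) + 2) = j * (4 * h + 2) + (4 * h + 2) := by ring
      exact Or.inl ⟨j, rfl, by omega, Or.inl (by omega)⟩
    | left j i h0 h1 => exact Or.inr (Or.inl ⟨j, by omega, rfl⟩)
    | next j i hi =>
      have := mono j (j + 1) (by omega)
      have := S.pole_pos (j + 1)
      refine Or.inl ⟨j, rfl, by omega, ?_⟩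
      rcases hi with rfl | rfl | rfl
      · exact Or.inl (by omega)
      · exact Or.inl (by omega)
      · exact Or.inr rfl
    | three j hj =>
      exact Or.inr (Or.inr ⟨j, hj, rfl, by rw [S.pole_congr (i := j + 3) (j := j) (by omega)]⟩)
  have lt_of : ∀ i j, i * (4 * h + 2) + S.pole i < j * (4 * h + 2) + S.pole j → i < j := by
    intro i j hij
    by_contra hc
    rcases (not_lt.1 hc).lt_or_eq with hl | rfl
    · have := mono j i hl
      have := S.pole_pos i
      omega
    · omega
  have mono' : ∀ i j, i ≤ j → i * (4 * h + 2) + S.pole i ≤ j * (4 * h + 2) + S.pole j := by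
    intro i j hij
    rcases hij.lt_or_eq with hl | rfl
    · have := mono i j hl
      have := S.pole_pos j
      omega
    · exact le_rfl
  have start : ∀ i j : ℤ, i ≤ j → i * (4 * h + 2) ≤ j * (4 * h + 2) := fun i j hij => by
    have := mul_block_le h 0 (i := i) (j := j) (by omega)
    omega
  have bd : ∀ j b : ℤ, (b ≤ (j + 1) * (4 * h + 2) + 1 ∨
      b = (j + 1) * (4 * h + 2) + S.pole (j + 1)) →
      b ≤ (j + 1) * (4 * h + 2) + S.pole (j + 1) := by
    intro j b hb
    have := S.pole_pos (j + 1)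
    omega
  rcases form a b hab with ⟨j, rfl, hlt, hb⟩ | ⟨j, hj, rfl⟩ | ⟨j, hj, rfl, rfl⟩ <;>
    rcases form c d hcd with ⟨k, rfl, hlt', hd⟩ | ⟨k, hk, rfl⟩ | ⟨k, hk, rfl, rfl⟩
  · have := mono' (j + 1) k (by have := lt_of _ _ h1; omega)
    have := bd _ _ hb
    omega
  · have hjk : j < k := lt_of _ _ (h1.trans (h2.trans h3))
    rcases hb with hb | rfl
    · have := start (j + 1) k (by omega)
      omega
    · have := lt_of _ _ h3
      have := mono (j + 1) k this
      omega
  · have := mono' (j + 1) k (by have := lt_of _ _ h1; omega)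
    have := bd _ _ hb
    omega
  · have := mono k j (lt_of _ _ h2)
    omega
  · have := mono j k (lt_of _ _ h3)
    omega
  · have := mono k j (lt_of _ _ h2)
    omega
  · have := mono' (k + 1) (j + 3) (by have := lt_of _ _ h2; omega)
    have := bd _ _ hd
    omega
  · have := mono (j + 3) k (lt_of _ _ h3)
    omega
  · have := lt_of _ _ h1
    have := lt_of _ _ h2
    omega

/-! ### The labelled periodic graph -/

/-- The number of vertices. -/
abbrev size (h : ℕ) : ℕ := 3 * (2 * h + 1) * (4 * h + 2)

/-- The label of a place on the axis. -/
def label (p : ℤ) : ZMod (6 * (2 * h + 1)) :=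
  ((2 * (p / (4 * h + 2)) +
    (S.block (p / (4 * h + 2) % 3)).offset (p % (4 * h + 2)).toNat : ℤ) : ZMod _)

theorem Lower.add_period (a b : ℤ) (hab : S.Lower a b) (k : ℤ) :
    S.Lower (a + k * size h) (b + k * size h) := by
  have e : ∀ j : ℤ, j * (4 * h + 2) + k * size h = (j + 3 * (k * (2 * h + 1))) * (4 * h + 2) := by
    intro j
    push_cast
    ring
  have e' : ∀ j c : ℤ, (j + c) * (4 * h + 2) + k * size h =
      (j + 3 * (k * (2 * h + 1)) + c) * (4 * h + 2) := by
    intro j c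
    push_cast
    ring
  cases hab with
  | step p => rw [add_right_comm]; exact Lower.step _
  | spoke j i h0 h1 h2 =>
    rw [add_right_comm, e]
    exact Lower.spoke _ i h0 h1 (fun hc => h2 ⟨by omega, hc.2⟩)
  | bypass j hj =>
    have := Lower.bypass (S := S) (j + 3 * (k * (2 * h + 1))) (by omega)
    rw [← e] at this
    convert this using 1 <;> ring
  | next j => rw [e, e']; exact Lower.next _
  | two j hj => rw [e, e']; exact Lower.two _ (by omega)
  | three j hj => rw [e, e']; exact Lower.three _ (by omega)

theorem Upper.add_period (a b : ℤ) (hab : S.Upper a b) (k : ℤ) :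
    S.Upper (a + k * size h) (b + k * size h) := by
  have e : ∀ j : ℤ, j * (4 * h + 2) + k * size h = (j + 3 * (k * (2 * h + 1))) * (4 * h + 2) := by
    intro j
    push_cast
    ring
  have e' : ∀ j c : ℤ, (j + c) * (4 * h + 2) + k * size h =
      (j + 3 * (k * (2 * h + 1)) + c) * (4 * h + 2) := by
    intro j c
    push_cast
    ring
  have hp : ∀ j, S.pole j = S.pole (j + 3 * (k * (2 * h + 1))) := fun j =>
    S.pole_congr (by omega)
  cases hab with
  | right j i h0 h1 =>
    rw [add_right_comm, e, add_right_comm, e, hp j]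
    rw [hp j] at h0
    exact Upper.right _ i h0 h1
  | left j i h0 h1 =>
    rw [add_right_comm, e, add_right_comm, e, hp j]
    rw [hp j] at h1
    exact Upper.left _ i h0 h1
  | next j i hi =>
    rw [add_right_comm, e, add_right_comm, e', hp j]
    rw [hp (j + 1), add_right_comm] at hi
    exact Upper.next _ i hi
  | three j hj =>
    rw [add_right_comm, e, add_right_comm, e', hp j]
    exact Upper.three _ (by omega)

theorem Lower.bounds (hh : 2 ≤ h) (a b : ℤ) (hab : S.Lower a b) : a < b ∧ b < a + size h := by
  have f1 := S.flipPlace_pos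
  have f2 := S.flipPlace_lt
  have hN : (4 : ℤ) * (4 * h + 2) ≤ size h := by
    push_cast
    nlinarith
  cases hab with
  | step p => omega
  | spoke j i h0 h1 h2 => omega
  | bypass j hj => omega
  | next j =>
    have : (j + 1) * (4 * (h : ℤ) + 2) = j * (4 * h + 2) + (4 * h + 2) := by ring
    omega
  | two j hj =>
    have : (j + 2) * (4 * (h : ℤ) + 2) = j * (4 * h + 2) + 2 * (4 * h + 2) := by ring
    omega
  | three j hj =>
    have : (j + 3) * (4 * (h : ℤ) + 2) = j * (4 * h + 2) + 3 * (4 * h + 2) := by ring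
    omega

theorem Upper.bounds (hh : 2 ≤ h) (a b : ℤ) (hab : S.Upper a b) : a < b ∧ b < a + size h := by
  have hN : (4 : ℤ) * (4 * h + 2) ≤ size h := by
    push_cast
    nlinarith
  cases hab with
  | right j i h0 h1 =>
    have := S.pole_pos j
    omega
  | left j i h0 h1 =>
    have := S.pole_lt j
    omega
  | next j i hi =>
    have : (j + 1) * (4 * (h : ℤ) + 2) = j * (4 * h + 2) + (4 * h + 2) := by ring
    have := S.pole_lt (j + 1)
    have := S.pole_pos (j + 1)
    have := S.pole_lt j
    have := S.pole_pos j
    omega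
  | three j hj =>
    have : (j + 3) * (4 * (h : ℤ) + 2) = j * (4 * h + 2) + 3 * (4 * h + 2) := by ring
    omega

/-- The places on the axis modulo the period, with the edges above and below the axis. -/
def graph : SimpleGraph (Fin (size h)) :=
  SimpleGraph.fromRel fun u v => ∃ a b : ℤ, (S.Upper a b ∨ S.Lower a b) ∧
    a ≡ u [ZMOD size h] ∧ b ≡ v [ZMOD size h]

theorem isPlanar_graph (hh : 2 ≤ h) : IsPlanar S.graph := by
  refine isPlanar_of_periodic_book S.graph S.Upper S.Lower (Upper.add_period S)
    (Lower.add_period S) (Upper.bounds S hh) (Lower.bounds S hh) (Upper.not_interleave S)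
    (Lower.not_interleave S) ?_
  intro u v huv
  rcases ((SimpleGraph.fromRel_adj _ _ _).1 huv).2 with ⟨a, b, h1, h2, h3⟩ | ⟨a, b, h1, h2, h3⟩
  · exact ⟨a, b, h1, Or.inl ⟨h2, h3⟩⟩
  · exact ⟨a, b, h1, Or.inr ⟨h2, h3⟩⟩

theorem connected_graph : S.graph.Connected := by
  have hN : 0 < size h := by positivity
  have : ∀ n (hn : n < size h), S.graph.Reachable ⟨0, hN⟩ ⟨n, hn⟩ := by
    intro n
    induction n with
    | zero => exact fun _ => SimpleGraph.Reachable.refl _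
    | succ n ih =>
      intro hn
      refine (ih (by omega)).trans (SimpleGraph.Adj.reachable ?_)
      refine (SimpleGraph.fromRel_adj _ _ _).2 ⟨by simp, Or.inl ⟨n, n + 1, Or.inr (Lower.step _),
        ?_, ?_⟩⟩
      · exact Int.ModEq.refl _
      · simp only [Nat.cast_add, Nat.cast_one]
        exact Int.ModEq.refl _
  have hne : Nonempty (Fin (size h)) := ⟨⟨0, hN⟩⟩
  exact SimpleGraph.Connected.mk fun u v => (this u u.2).symm.trans (this v v.2)

/-- A period is 3m blocks, which preserves the type modulo 3 and raises the label by 6m. -/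
theorem label_add_period (p k : ℤ) : S.label (p + k * size h) = S.label p := by
  have hL : (4 * (h : ℤ) + 2) ≠ 0 := by positivity
  have e : k * (size h : ℤ) = (3 * (k * (2 * h + 1))) * (4 * h + 2) := by
    push_cast
    ring
  unfold label
  rw [e, Int.add_mul_ediv_right _ _ hL, Int.add_mul_emod_self_right, Int.add_mul_emod_self_left]
  have : 2 * (p / (4 * h + 2) + 3 * (k * (2 * (h : ℤ) + 1))) = 2 * (p / (4 * h + 2)) +
    ((6 * (2 * h + 1) : ℕ) : ℤ) * k := by push_cast; ring
  rw [this]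
  push_cast
  have h0 : ((6 : ZMod (6 * (2 * h + 1))) * (2 * h + 1)) = 0 := by
    exact_mod_cast ZMod.natCast_self (6 * (2 * h + 1))
  rw [h0]
  ring

theorem label_congr {p q : ℤ} (hpq : p ≡ q [ZMOD size h]) : S.label p = S.label q := by
  obtain ⟨k, hk⟩ := hpq.dvd
  have : q = p + k * size h := by linarith
  rw [this, label_add_period]

theorem label_mul_add (j : ℤ) (i : ℕ) (hi : i < 4 * h + 2) :
    S.label (j * (4 * h + 2) + i) = ((2 * j + (S.block (j % 3)).offset i : ℤ) : ZMod _) := by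
  have hL : (4 * (h : ℤ) + 2) ≠ 0 := by positivity
  have e1 : (j * (4 * (h : ℤ) + 2) + i) / (4 * h + 2) = j := by
    rw [add_comm, Int.add_mul_ediv_right _ _ hL, Int.ediv_eq_zero_of_lt (by positivity)
      (by exact_mod_cast hi), zero_add]
  have e2 : (j * (4 * (h : ℤ) + 2) + i) % (4 * h + 2) = i := by
    rw [add_comm, Int.add_mul_emod_self_right, Int.emod_eq_of_lt (by positivity)
      (by exact_mod_cast hi)]
  unfold label
  rw [e1, e2, Int.toNat_natCast]

theorem label_start (j : ℤ) : S.label (j * (4 * h + 2)) = ((2 * j + 1 : ℤ) : ZMod _) := by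
  have := S.label_mul_add j 0 (by omega)
  rwa [FanBlock.offset_zero, Nat.cast_zero, add_zero] at this

theorem label_pole (j : ℤ) :
    S.label (j * (4 * h + 2) + S.pole j) = ((2 * j + 2 : ℤ) : ZMod _) := by
  have := S.pole_lt j
  have h1 := S.label_mul_add j ((S.block (j % 3)).cut + 1) (by unfold pole at this; omega)
  rw [FanBlock.offset_cut] at h1
  rw [← h1]
  simp [pole]

theorem label_place (j : ℤ) (p : ℕ) (hp : p < 4 * h) :
    S.label (j * (4 * h + 2) + (S.block (j % 3)).place p) =
      ((2 * j + (S.block (j % 3)).s p : ℤ) : ZMod _) := by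
  rw [S.label_mul_add j _ (by unfold FanBlock.place; split_ifs <;> omega), FanBlock.offset_place]

/-- Two integers are neighbours if an edge joins two places with these labels. -/
def Neighbours (x y : ℤ) : Prop :=
  ∃ a b : ℤ, (S.Upper a b ∨ S.Lower a b) ∧ (S.label a = x ∧ S.label b = y ∨
    S.label a = y ∧ S.label b = x)

variable {S}

theorem Neighbours.symm {x y : ℤ} (hxy : S.Neighbours x y) : S.Neighbours y x := by
  obtain ⟨a, b, h1, h2⟩ := hxy
  exact ⟨a, b, h1, h2.symm⟩

theorem Neighbours.congr {x y x' y' : ℤ} (hxy : S.Neighbours x y)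
    (hx : ∃ k, x' = x + k * (12 * h + 6)) (hy : ∃ k, y' = y + k * (12 * h + 6)) :
    S.Neighbours x' y' := by
  have key : ∀ x x' : ℤ, (∃ k, x' = x + k * (12 * h + 6)) →
      ((x' : ℤ) : ZMod (6 * (2 * h + 1))) = x := by
    rintro x x' ⟨k, rfl⟩
    have h0 : ((6 : ZMod (6 * (2 * h + 1))) * (2 * h + 1)) = 0 := by
      exact_mod_cast ZMod.natCast_self (6 * (2 * h + 1))
    have : x + k * (12 * (h : ℤ) + 6) = x + (6 * (2 * h + 1)) * k := by ring
    rw [this]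
    push_cast
    rw [h0, zero_mul, add_zero]
  obtain ⟨a, b, h1, h2⟩ := hxy
  refine ⟨a, b, h1, ?_⟩
  rw [key _ _ hx, key _ _ hy]
  exact h2

theorem neighbours_of_upper {a b x y : ℤ} (hab : S.Upper a b) (ha : S.label a = x)
    (hb : S.label b = y) : S.Neighbours x y := ⟨a, b, Or.inl hab, Or.inl ⟨ha, hb⟩⟩

theorem neighbours_of_lower {a b x y : ℤ} (hab : S.Lower a b) (ha : S.label a = x)
    (hb : S.label b = y) : S.Neighbours x y := ⟨a, b, Or.inr hab, Or.inl ⟨ha, hb⟩⟩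

variable (S)

end FanSystem

/-! ### All pairs of labels are neighbours -/

namespace FanBlock

variable {h : ℕ} (B : FanBlock h)

theorem place_lt {p : ℕ} (hp : p < 4 * h) : B.place p < 4 * h + 2 := by
  unfold place
  split_ifs <;> omega

theorem place_pos (p : ℕ) : 0 < B.place p := by
  unfold place
  split_ifs <;> omega

theorem place_ne (p : ℕ) : B.place p ≠ B.cut + 1 := by
  unfold place
  split_ifs <;> omega

theorem place_zero : B.place 0 = 1 := if_pos B.cut_pos

theorem place_succ {p : ℕ} (hp : p + 1 ≠ B.cut) : B.place (p + 1) = B.place p + 1 := by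
  unfold place
  split_ifs <;> omega

theorem place_injective : Function.Injective B.place := by
  intro p q hpq
  unfold place at hpq
  split_ifs at hpq <;> omega

theorem place_last : B.place (4 * h - 1) = 4 * h + 1 := by
  have := B.cut_lt
  unfold place
  split_ifs <;> omega

end FanBlock

namespace FanSystem

variable {h : ℕ} (S : FanSystem h)

theorem neighbours_one (n : ℤ) : S.Neighbours n (n + 1) := by
  obtain ⟨j, rfl | rfl⟩ : ∃ j, n = 2 * j + 1 ∨ n = 2 * j + 2 := ⟨(n - 1) / 2, by omega⟩
  · refine neighbours_of_lower (Lower.spoke j (S.pole j) ?_ ?_ ?_) (S.label_start j) ?_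
    · have := S.pole_pos j
      omega
    · have := S.pole_lt j
      omega
    -- The spoke to the second pole is never the omitted one: the omitted one leads to a content.
    · rintro ⟨hj, hp⟩
      unfold pole flipPlace at hp
      rw [hj] at hp
      exact (S.block 1).place_ne S.flip (by omega)
    · rw [label_pole]
      congr 1
      ring
  · refine neighbours_of_upper (Upper.next j 0 (Or.inl rfl)) (S.label_pole j) ?_
    rw [add_zero, label_start]
    congr 1
    ring

theorem neighbours_two (n : ℤ) : S.Neighbours n (n + 2) := by
  obtain ⟨j, rfl | rfl⟩ : ∃ j, n = 2 * j + 1 ∨ n = 2 * j + 2 := ⟨(n - 1) / 2, by omega⟩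
  · refine neighbours_of_lower (Lower.next j) (S.label_start j) ?_
    rw [label_start]
    congr 1
    ring
  · refine neighbours_of_upper (Upper.next j _ (Or.inr (Or.inr rfl))) (S.label_pole j) ?_
    rw [label_pole]
    congr 1
    ring

/-- This is the purpose of the condition `last`: the final content of block `j - 1` has label
`2(j-1) + 6` and precedes the start of block `j` on the axis. -/
theorem neighbours_three (j : ℤ) : S.Neighbours (2 * j + 4) (2 * j + 1) := by
  have hlt := (S.block ((j - 1) % 3)).cut_lt
  refine neighbours_of_lower (Lower.step (j * (4 * h + 2) - 1)) ?_ ?_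
  · have h1 := S.label_place (j - 1) (4 * h - 1) (by omega)
    rw [FanBlock.place_last, FanBlock.last] at h1
    have e : (j - 1) * (4 * (h : ℤ) + 2) + ((4 * h + 1 : ℕ) : ℤ) = j * (4 * h + 2) - 1 := by
      push_cast
      ring
    rw [← e, h1]
    congr 1
    ring
  · rw [sub_add_cancel, label_start]

theorem neighbours_pole_content (j : ℤ) (p : ℕ) (hp : p < 4 * h) :
    S.Neighbours (2 * j + 2) (2 * j + (S.block (j % 3)).s p) := by
  have h1 := (S.block (j % 3)).place_lt hp
  have h2 := (S.block (j % 3)).place_pos p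
  have h3 := (S.block (j % 3)).place_ne p
  rcases lt_or_gt_of_ne h3 with hl | hl
  · refine (neighbours_of_upper (Upper.left j ((S.block (j % 3)).place p) (by omega) ?_)
      (S.label_place j p hp) (S.label_pole j)).symm
    unfold pole
    omega
  · refine neighbours_of_upper (Upper.right j ((S.block (j % 3)).place p) ?_ (by omega))
      (S.label_pole j) (S.label_place j p hp)
    unfold pole
    omega

/-- The spoke to the bypassed vertex is missing, but its label `2j+5` is also that of the start of
block `j + 2`. -/
theorem neighbours_start_content (j : ℤ) (p : ℕ) (hp : p < 4 * h) :
    S.Neighbours (2 * j + 1) (2 * j + (S.block (j % 3)).s p) := by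
  have h1 := (S.block (j % 3)).place_lt hp
  have h2 := (S.block (j % 3)).place_pos p
  by_cases hc : j % 3 = 1 ∧ ((S.block (j % 3)).place p : ℤ) = S.flipPlace
  · obtain ⟨hj, hc⟩ := hc
    rw [hj, flipPlace, Nat.cast_inj] at hc
    rw [hj, (S.block 1).place_injective hc, S.flip_label]
    refine neighbours_of_lower (Lower.two j hj) (S.label_start j) ?_
    rw [label_start]
    congr 1
    ring
  · exact neighbours_of_lower (Lower.spoke j _ (by omega) (by omega) hc)
      (S.label_start j) (S.label_place j p hp)

/-- The three kinds of links are axis steps, the edge from the second pole of block `j - 1` (label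
`2j`) to the first content, and the extra edge of the type of the block. -/
theorem neighbours_of_linked (j a b : ℤ) (hab : (S.block (j % 3)).Linked a b) :
    S.Neighbours (2 * j + a) (2 * j + b) := by
  have hlt := (S.block (j % 3)).cut_lt
  have hL : (j - 1) + 1 = j := by ring
  rcases hab with ⟨p, hp, hpc, rfl, rfl⟩ | ⟨rfl, rfl⟩ | hab
  · refine neighbours_of_lower (Lower.step _) (S.label_place j p (by omega)) ?_
    rw [← S.label_place j (p + 1) hp, (S.block (j % 3)).place_succ hpc]
    push_cast
    rw [add_assoc]
  · refine neighbours_of_upper (Upper.next (j - 1) 1 (Or.inr (Or.inl rfl)))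
      (S.label_pole _) (y := 2 * j + (S.block (j % 3)).s 0) ?_ |>.congr ⟨0, by ring⟩ ⟨0, by ring⟩
    rw [hL, ← S.label_place j 0 (by omega), FanBlock.place_zero, Nat.cast_one]
  · have hj : j % 3 = 0 ∨ j % 3 = 1 ∨ j % 3 = 2 := by omega
    rcases hj with hj | hj | hj
    · rw [hj, S.extra_zero, Prod.mk.injEq] at hab
      obtain ⟨rfl, rfl⟩ := hab
      refine (neighbours_of_upper (Upper.three (j - 1) (by omega))
        (S.label_pole (j - 1)) (y := 2 * j + 6) ?_).congr ⟨0, by ring⟩ ⟨0, by ring⟩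
      rw [S.pole_congr (i := j - 1) (j := j - 1 + 3) (by omega), label_pole]
      congr 1
      ring
    · rw [hj, S.extra_one, Prod.mk.injEq] at hab
      obtain ⟨rfl, rfl⟩ := hab
      have f1 := S.flip_pos
      have f2 := S.flip_lt
      have f3 := S.flip_ne
      have f4 := S.flip_succ_ne
      have e1 := (S.block 1).place_succ (p := S.flip - 1) (by omega)
      rw [Nat.sub_add_cancel f1] at e1
      have e2 := (S.block 1).place_succ f4
      have l1 := S.label_place j (S.flip - 1) (by omega)
      have l2 := S.label_place j (S.flip + 1) (by omega)
      rw [hj] at l1 l2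
      refine neighbours_of_lower (Lower.bypass j hj) ?_ ?_
      · rw [← l1, flipPlace, e1]
        congr 1
        push_cast
        ring
      · rw [← l2, flipPlace, e2]
        congr 1
        push_cast
        ring
    · rw [hj, S.extra_two, Prod.mk.injEq] at hab
      obtain ⟨rfl, rfl⟩ := hab
      refine (neighbours_of_lower (Lower.three (j - 1) (by omega))
        (S.label_start (j - 1)) (y := 2 * j + 5) ?_).congr ⟨0, by ring⟩ ⟨0, by ring⟩
      rw [label_start]
      congr 1
      ring

theorem exists_content_even (g : ℤ) (i : ℤ) (hi : ¬(2 * (h : ℤ) + 1) ∣ i) :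
    ∃ p < 4 * h, ∃ k : ℤ, 6 * i = (S.block g).s p + k * (12 * h + 6) := by
  have hm : (0 : ℤ) < 2 * h + 1 := by positivity
  have h1 := Int.emod_nonneg i hm.ne'
  have h2 := Int.emod_lt_of_pos i hm
  have h3 : i % (2 * h + 1) ≠ 0 := fun hc => hi (Int.dvd_of_emod_eq_zero hc)
  have h4 := Int.emod_add_mul_ediv i (2 * h + 1)
  obtain ⟨p, hp, hs | hs⟩ := (S.block g).mem_even (i % (2 * h + 1)) (by omega) (by omega)
  · exact ⟨p, hp, i / (2 * h + 1), by rw [hs]; linear_combination -6 * h4⟩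
  · exact ⟨p, hp, i / (2 * h + 1) + 1, by rw [hs]; linear_combination -6 * h4⟩

theorem exists_content_odd (g : ℤ) (i : ℤ) (hi : ¬(2 * (h : ℤ) + 1) ∣ i) :
    ∃ p < 4 * h, ∃ k : ℤ, 6 * i - 1 = (S.block g).s p + k * (12 * h + 6) := by
  have hm : (0 : ℤ) < 2 * h + 1 := by positivity
  have h1 := Int.emod_nonneg i hm.ne'
  have h2 := Int.emod_lt_of_pos i hm
  have h3 : i % (2 * h + 1) ≠ 0 := fun hc => hi (Int.dvd_of_emod_eq_zero hc)
  have h4 := Int.emod_add_mul_ediv i (2 * h + 1)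
  obtain ⟨p, hp, hs | hs⟩ := (S.block g).mem_odd (i % (2 * h + 1)) (by omega) (by omega)
  · exact ⟨p, hp, i / (2 * h + 1), by rw [hs]; linear_combination -6 * h4⟩
  · exact ⟨p, hp, i / (2 * h + 1) + 1, by rw [hs]; linear_combination -6 * h4⟩

/-- When m divides `i` the label is not among the contents of block `j`; exactly the differences 1,
2, 2, 3 remain. -/
theorem neighbours_cross (j i : ℤ) :
    (S.Neighbours (2 * j + 1) (2 * j + 6 * i) ∧ S.Neighbours (2 * j + 2) (2 * j + 6 * i)) ∧
    S.Neighbours (2 * j + 1) (2 * j + 6 * i - 1) ∧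
      S.Neighbours (2 * j + 2) (2 * j + 6 * i - 1) := by
  by_cases hi : (2 * (h : ℤ) + 1) ∣ i
  · obtain ⟨k, rfl⟩ := hi
    refine ⟨⟨?_, ?_⟩, ?_, ?_⟩
    · exact (S.neighbours_one (2 * j)).symm.congr ⟨0, by ring⟩ ⟨k, by ring⟩
    · exact (S.neighbours_two (2 * j)).symm.congr ⟨0, by ring⟩ ⟨k, by ring⟩
    · exact (S.neighbours_two (2 * j - 1)).symm.congr ⟨0, by ring⟩ ⟨k, by ring⟩
    · exact (S.neighbours_three (j - 1)).congr ⟨0, by ring⟩ ⟨k, by ring⟩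
  · obtain ⟨p, hp, k, hk⟩ := S.exists_content_even (j % 3) i hi
    obtain ⟨q, hq, l, hl⟩ := S.exists_content_odd (j % 3) i hi
    refine ⟨⟨?_, ?_⟩, ?_, ?_⟩
    · exact (S.neighbours_start_content j p hp).congr ⟨0, by ring⟩
        ⟨k, by linear_combination hk⟩
    · exact (S.neighbours_pole_content j p hp).congr ⟨0, by ring⟩
        ⟨k, by linear_combination hk⟩
    · exact (S.neighbours_start_content j q hq).congr ⟨0, by ring⟩
        ⟨l, by linear_combination hl⟩
    · exact (S.neighbours_pole_content j q hq).congr ⟨0, by ring⟩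
        ⟨l, by linear_combination hl⟩

theorem neighbours_of_linked_symm (j a b : ℤ)
    (hab : (S.block (j % 3)).Linked a b ∨ (S.block (j % 3)).Linked b a) :
    S.Neighbours (2 * j + a) (2 * j + b) :=
  hab.elim (S.neighbours_of_linked j a b) fun h => (S.neighbours_of_linked j b a h).symm

theorem neighbours_even_aux (n d : ℤ) (h1 : 1 ≤ d) (h2 : d ≤ h) :
    S.Neighbours (2 * n) (2 * n + 6 * d) := by
  obtain ⟨a, b, hab, ha, hd⟩ := (S.complete (n % 3)).even d h1 h2
  obtain ⟨i, rfl⟩ : ∃ i, a = 6 * i := ⟨a / 6, by omega⟩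
  -- Block `n - 3i` has the same type as `n` and shifts the linked label `6i` to `2n`.
  rw [show n % 3 = (n - 3 * i) % 3 by omega] at hab
  refine (S.neighbours_of_linked_symm (n - 3 * i) _ _ hab).congr ⟨0, by ring⟩ ?_
  rcases hd with hd | hd
  · exact ⟨0, by linear_combination -hd⟩
  · exact ⟨1, by linear_combination -hd⟩

theorem neighbours_odd_aux (n d : ℤ) (h1 : 1 ≤ d) (h2 : d ≤ h) :
    S.Neighbours (2 * n - 1) (2 * n - 1 + 6 * d) := by
  obtain ⟨a, b, hab, ha, hd⟩ := (S.complete (n % 3)).odd d h1 h2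
  obtain ⟨i, rfl⟩ : ∃ i, a = 6 * i - 1 := ⟨(a + 1) / 6, by omega⟩
  rw [show n % 3 = (n - 3 * i) % 3 by omega] at hab
  refine (S.neighbours_of_linked_symm (n - 3 * i) _ _ hab).congr ⟨0, by ring⟩ ?_
  rcases hd with hd | hd
  · exact ⟨0, by linear_combination -hd⟩
  · exact ⟨1, by linear_combination -hd⟩

/-- Exchanging the two ends turns a difference d into m - d, so differences up to h suffice. -/
theorem neighbours_of_aux (x : ℤ)
    (hx : ∀ k d : ℤ, 1 ≤ d → d ≤ h → S.Neighbours (x + 6 * k) (x + 6 * k + 6 * d)) (d : ℤ)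
    (hd : ¬(2 * (h : ℤ) + 1) ∣ d) : S.Neighbours x (x + 6 * d) := by
  have hm : (0 : ℤ) < 2 * h + 1 := by positivity
  have h1 := Int.emod_nonneg d hm.ne'
  have h2 := Int.emod_lt_of_pos d hm
  have h3 : d % (2 * h + 1) ≠ 0 := fun hc => hd (Int.dvd_of_emod_eq_zero hc)
  have h4 := Int.emod_add_mul_ediv d (2 * h + 1)
  rcases le_or_gt (d % (2 * h + 1)) h with hl | hl
  · exact (hx 0 _ (by omega) hl).congr ⟨0, by ring⟩
      ⟨d / (2 * h + 1), by linear_combination -6 * h4⟩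
  · refine (hx d (2 * h + 1 - d % (2 * h + 1)) (by omega) (by omega)).symm.congr
      ⟨-(d / (2 * h + 1)) - 1, ?_⟩ ⟨0, by ring⟩
    linear_combination 6 * h4

theorem neighbours_mixed (n d : ℤ) : S.Neighbours (2 * n) (2 * n + 6 * d - 1) := by
  have hm : (0 : ℤ) < 2 * h + 1 := by positivity
  have h1 := Int.emod_nonneg d hm.ne'
  have h2 := Int.emod_lt_of_pos d hm
  have h4 := Int.emod_add_mul_ediv d (2 * h + 1)
  by_cases h3 : d % (2 * h + 1) = 0
  · exact (S.neighbours_one (2 * n - 1)).symm.congr ⟨0, by ring⟩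
      ⟨d / (2 * h + 1), by rw [h3] at h4; linear_combination -6 * h4⟩
  · obtain ⟨a, b, hab, ha, hd⟩ := (S.complete (n % 3)).mixed _ (by omega : 1 ≤ d % (2 * h + 1))
      (by omega)
    obtain ⟨i, rfl⟩ : ∃ i, a = 6 * i := ⟨a / 6, by omega⟩
    rw [show n % 3 = (n - 3 * i) % 3 by omega] at hab
    refine (S.neighbours_of_linked_symm (n - 3 * i) _ _ hab).congr ⟨0, by ring⟩ ?_
    rcases hd with hd | hd
    · exact ⟨d / (2 * h + 1), by linear_combination -hd - 6 * h4⟩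
    · exact ⟨d / (2 * h + 1) + 1, by linear_combination -hd - 6 * h4⟩

/-- The class of a label `x` is `(x + 1) / 2` modulo 3. Different classes are consecutive in one of
the two orders, which is the cross case; equal classes use the linked pairs. -/
theorem neighbours_all (x y : ℤ) (hxy : ¬(12 * (h : ℤ) + 6) ∣ y - x) : S.Neighbours x y := by
  have hdiv : ∀ d : ℤ, y - x = 6 * d → ¬(2 * (h : ℤ) + 1) ∣ d := by
    rintro d hd ⟨k, rfl⟩
    exact hxy ⟨k, by rw [hd]; ring⟩
  have cross : ∀ x y : ℤ, ((y + 1) / 2 - (x + 1) / 2) % 3 = 1 → S.Neighbours y x := by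
    intro x y hm
    obtain ⟨j, hj⟩ : ∃ j, j = (y + 1) / 2 - 1 := ⟨_, rfl⟩
    obtain ⟨i, hi⟩ : ∃ i, (x + 1) / 2 = j + 3 * i := ⟨((x + 1) / 2 - j) / 3, by omega⟩
    obtain ⟨⟨c1, c2⟩, c3, c4⟩ := S.neighbours_cross j i
    have hx : x = 2 * j + 6 * i ∨ x = 2 * j + 6 * i - 1 := by omega
    have hy : y = 2 * j + 1 ∨ y = 2 * j + 2 := by omega
    rcases hx with rfl | rfl <;> rcases hy with rfl | rfl <;> assumption
  have hm : ((y + 1) / 2 - (x + 1) / 2) % 3 = 0 ∨ ((y + 1) / 2 - (x + 1) / 2) % 3 = 1 ∨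
    ((x + 1) / 2 - (y + 1) / 2) % 3 = 1 := by omega
  rcases hm with hm | hm | hm
  · obtain ⟨n, hn⟩ : ∃ n, n = (x + 1) / 2 := ⟨_, rfl⟩
    obtain ⟨d, hd⟩ : ∃ d, (y + 1) / 2 = n + 3 * d := ⟨((y + 1) / 2 - n) / 3, by omega⟩
    have hx : x = 2 * n ∨ x = 2 * n - 1 := by omega
    have hy : y = 2 * n + 6 * d ∨ y = 2 * n + 6 * d - 1 := by omega
    rcases hx with rfl | rfl <;> rcases hy with rfl | rfl
    · refine S.neighbours_of_aux _ (fun k e h1 h2 => ?_) d (hdiv d (by ring))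
      have := S.neighbours_even_aux (n + 3 * k) e h1 h2
      convert this using 1 <;> ring
    · exact S.neighbours_mixed n d
    · have := (S.neighbours_mixed (n + 3 * d) (-d)).symm
      convert this using 1 <;> ring
    · have := S.neighbours_of_aux (2 * n - 1) (fun k e h1 h2 => ?_) d (hdiv d (by ring))
      · convert this using 1
        ring
      · have := S.neighbours_odd_aux (n + 3 * k) e h1 h2
        convert this using 1 <;> ring
  · exact (cross x y hm).symm
  · exact cross y x hm

/-! ### Sizes of the empires -/

/-- The value `k = 0` gives the pole with label `n`; for `k ≠ 0` the label is the content at offset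
`-6k` or `-6k - 1` of block `(n + 1) / 2 + 3k`. Recording the block shows later that these places
are distinct. -/
theorem exists_label_eq (n k : ℤ) (h0 : 0 ≤ k) (hk : k < 2 * h + 1) :
    ∃ p : ℤ, S.label p = n ∧
      p / (4 * h + 2) = if k = 0 then (n + 1) / 2 - 1 else (n + 1) / 2 + 3 * k := by
  have hL : (4 * (h : ℤ) + 2) ≠ 0 := by positivity
  have hdiv : ∀ j i : ℤ, 0 ≤ i → i < 4 * h + 2 → (j * (4 * (h : ℤ) + 2) + i) / (4 * h + 2) = j := by
    intro j i h1 h2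
    rw [add_comm, Int.add_mul_ediv_right _ _ hL, Int.ediv_eq_zero_of_lt h1 h2, zero_add]
  obtain ⟨j, hj⟩ : ∃ j, (n + 1) / 2 = j := ⟨_, rfl⟩
  have hn : n = 2 * j ∨ n = 2 * j - 1 := by omega
  rw [hj]
  split_ifs with hk0
  · rcases hn with rfl | rfl
    · refine ⟨(j - 1) * (4 * h + 2) + S.pole (j - 1), ?_, ?_⟩
      · rw [label_pole]
        congr 1
        ring
      · have := S.pole_pos (j - 1)
        have := S.pole_lt (j - 1)
        exact hdiv _ _ (by omega) (by omega)
    · refine ⟨(j - 1) * (4 * h + 2) + 0, ?_, hdiv _ _ le_rfl (by positivity)⟩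
      rw [add_zero, label_start]
      congr 1
      ring
  · have hd : ¬(2 * (h : ℤ) + 1) ∣ -k := fun hc => by
      have := Int.le_of_dvd (by omega) ((dvd_neg).1 hc)
      omega
    have key : ∀ p < 4 * h, (∃ l : ℤ, n - 2 * (j + 3 * k) =
        (S.block ((j + 3 * k) % 3)).s p + l * (12 * h + 6)) → ∃ p : ℤ, S.label p = n ∧
        p / (4 * h + 2) = j + 3 * k := by
      rintro p hp ⟨l, hl⟩
      have := (S.block ((j + 3 * k) % 3)).place_lt hp
      refine ⟨(j + 3 * k) * (4 * h + 2) + (S.block ((j + 3 * k) % 3)).place p, ?_,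
        hdiv _ _ (by positivity) (by omega)⟩
      rw [label_place _ _ _ hp, ZMod.intCast_eq_intCast_iff_dvd_sub]
      exact ⟨l, by push_cast; linear_combination hl⟩
    rcases hn with rfl | rfl
    · obtain ⟨p, hp, l, hl⟩ := S.exists_content_even ((j + 3 * k) % 3) (-k) hd
      exact key p hp ⟨l, by linear_combination hl⟩
    · obtain ⟨p, hp, l, hl⟩ := S.exists_content_odd ((j + 3 * k) % 3) (-k) hd
      exact key p hp ⟨l, by linear_combination hl⟩

/-- The empire of a vertex. -/
def empire (v : Fin (size h)) : ZMod (6 * (2 * h + 1)) := S.label v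

theorem le_card_empire (α : ZMod (6 * (2 * h + 1))) :
    2 * h + 1 ≤ (Finset.univ.filter fun v => S.empire v = α).card := by
  obtain ⟨n, rfl⟩ := ZMod.intCast_surjective α
  have hN : (0 : ℤ) < size h := by
    have : 0 < size h := by positivity
    exact_mod_cast this
  have hL : (4 * (h : ℤ) + 2) ≠ 0 := by positivity
  have ex : ∀ k : Fin (2 * h + 1), ∃ p : ℤ, S.label p = n ∧ p / (4 * h + 2) =
      if ((k : ℕ) : ℤ) = 0 then (n + 1) / 2 - 1 else (n + 1) / 2 + 3 * ((k : ℕ) : ℤ) :=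
    fun k => S.exists_label_eq n k (by positivity) (by have := k.2; omega)
  choose p hp hpd using ex
  have hmod : ∀ k, 0 ≤ p k % size h ∧ p k % size h < size h := fun k =>
    ⟨Int.emod_nonneg _ hN.ne', Int.emod_lt_of_pos _ hN⟩
  let f : Fin (2 * h + 1) → Fin (size h) := fun k =>
    ⟨(p k % size h).toNat, by have := hmod k; omega⟩
  have hf : ∀ k, ((f k : ℕ) : ℤ) = p k % size h := fun k => Int.toNat_of_nonneg (hmod k).1
  have hinj : Function.Injective f := by
    intro k l hkl
    have h1 : p k % size h = p l % size h := by rw [← hf, ← hf, hkl]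
    obtain ⟨c, hc⟩ := (show p k ≡ p l [ZMOD size h] from h1).dvd
    have h2 : p l = p k + (3 * (c * (2 * h + 1))) * (4 * h + 2) := by
      rw [← sub_eq_iff_eq_add', hc]
      push_cast
      ring
    have h3 := hpd l
    rw [h2, Int.add_mul_ediv_right _ _ hL, hpd k] at h3
    have hk := k.2
    have hl := l.2
    -- The pole's block has another residue modulo 3 than the content blocks, so equal places force
    -- `k` and `l` to agree modulo m.
    have h4 : ((k : ℕ) : ℤ) - (l : ℕ) = -(c * (2 * h + 1)) := by
      split_ifs at h3 <;> omega
    have h5 : c = 0 := by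
      by_contra hc0
      rcases lt_or_gt_of_ne hc0 with hc' | hc'
      · have : c * (2 * (h : ℤ) + 1) ≤ -1 * (2 * h + 1) :=
          mul_le_mul_of_nonneg_right (by omega) (by positivity)
        omega
      · have : 1 * (2 * (h : ℤ) + 1) ≤ c * (2 * h + 1) :=
          mul_le_mul_of_nonneg_right (by omega) (by positivity)
        omega
    rw [h5] at h4
    apply Fin.ext
    omega
  calc 2 * h + 1 = (Finset.univ.image f).card := by
        rw [Finset.card_image_of_injective _ hinj, Finset.card_univ, Fintype.card_fin]
    _ ≤ _ := by
        refine Finset.card_le_card fun v hv => ?_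
        obtain ⟨k, -, rfl⟩ := Finset.mem_image.1 hv
        refine Finset.mem_filter.2 ⟨Finset.mem_univ _, ?_⟩
        rw [empire, hf, ← hp k]
        exact S.label_congr (Int.mod_modEq _ _)

/-- There are 6m empires with at least m vertices each and only 6m² vertices, so equality holds
throughout. -/
theorem card_empire (α : ZMod (6 * (2 * h + 1))) :
    (Finset.univ.filter fun v => S.empire v = α).card = 2 * h + 1 := by
  refine le_antisymm ?_ (S.le_card_empire α)
  by_contra hlt
  have h1 : ∑ β : ZMod (6 * (2 * h + 1)), (2 * h + 1) <
      ∑ β, (Finset.univ.filter fun v => S.empire v = β).card :=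
    Finset.sum_lt_sum (fun β _ => S.le_card_empire β) ⟨α, Finset.mem_univ _, not_le.1 hlt⟩
  rw [← Finset.card_eq_sum_card_fiberwise (fun _ _ => Finset.mem_univ _), Finset.card_univ,
    Fintype.card_fin, Finset.sum_const, Finset.card_univ, ZMod.card, smul_eq_mul] at h1
  apply absurd h1
  unfold size
  rw [not_lt]
  apply le_of_eq
  ring

theorem isJGraph : IsJGraph (6 * (2 * h + 1)) (2 * h + 1) S.graph S.empire where
  finite := inferInstance
  connected := S.connected_graph
  surjective α := by
    have h1 := S.card_empire α
    obtain ⟨v, hv⟩ := Finset.card_pos.1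
      (by omega : 0 < (Finset.univ.filter fun v => S.empire v = α).card)
    exact ⟨v, (Finset.mem_filter.1 hv).2⟩
  card_le α := by
    refine le_of_eq (Eq.trans ?_ (S.card_empire α))
    rw [← Set.ncard_coe_finset]
    congr 1
    ext v
    simp
  card_empires := by rw [Nat.card_eq_fintype_card, ZMod.card]
  neighbouring α β hαβ := by
    have hN : (0 : ℤ) < size h := by
      have : 0 < size h := by positivity
      exact_mod_cast this
    obtain ⟨x, rfl⟩ := ZMod.intCast_surjective α
    obtain ⟨y, rfl⟩ := ZMod.intCast_surjective β
    have hxy : ¬(12 * (h : ℤ) + 6) ∣ y - x := by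
      intro hdvd
      apply hαβ
      rw [ZMod.intCast_eq_intCast_iff_dvd_sub]
      convert hdvd using 1
      push_cast
      ring
    have vert : ∀ a : ℤ, ∃ v : Fin (size h), a ≡ v [ZMOD size h] := fun a => by
      have h1 := Int.emod_nonneg a hN.ne'
      have h2 := Int.emod_lt_of_pos a hN
      refine ⟨⟨(a % size h).toNat, by omega⟩, ?_⟩
      rw [Int.toNat_of_nonneg h1]
      exact (Int.mod_modEq _ _).symm
    obtain ⟨a, b, hab, hl⟩ := S.neighbours_all x y hxy
    obtain ⟨v, hv⟩ := vert a
    obtain ⟨w, hw⟩ := vert b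
    rw [S.label_congr hv, S.label_congr hw] at hl
    have hvw : v ≠ w := by
      rintro rfl
      rcases hl with ⟨h1, h2⟩ | ⟨h1, h2⟩
      · exact hαβ (h1.symm.trans h2)
      · exact hαβ (h2.symm.trans h1)
    have hadj : S.graph.Adj v w :=
      (SimpleGraph.fromRel_adj _ _ _).2 ⟨hvw, Or.inl ⟨a, b, hab, hv, hw⟩⟩
    rcases hl with ⟨h1, h2⟩ | ⟨h1, h2⟩
    · exact ⟨v, w, hadj, h1, h2⟩
    · exact ⟨w, v, hadj.symm, h2, h1⟩

end FanSystem

/-! ### Fan blocks from a single path -/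

/-- A sequence of labels with two marked steps, of difference `6` between two labels divisible by
`6` and between two labels congruent to `5`, such that the remaining steps and the first term
realise every other difference. -/
structure FanPath (h : ℕ) where
  /-- the labels -/
  s : ℕ → ℤ
  /-- the first marked step -/
  t₁ : ℕ
  /-- the second marked step -/
  t₂ : ℕ
  t₁_lt : t₁ + 1 < 4 * h
  t₂_lt : t₂ + 1 < 4 * h
  last : s (4 * h - 1) = 6
  mem_even : ∀ d : ℤ, 1 ≤ d → d ≤ 2 * h →
    ∃ p < 4 * h, s p = 6 * d ∨ s p = 6 * d - (12 * h + 6)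
  mem_odd : ∀ d : ℤ, 1 ≤ d → d ≤ 2 * h →
    ∃ p < 4 * h, s p = 6 * d - 1 ∨ s p = 6 * d - 1 - (12 * h + 6)
  -- Here `12h` is -6 modulo 6m.
  step₁ : s t₁ % 6 = 0 ∧ (s (t₁ + 1) - s t₁ = 6 ∨ s (t₁ + 1) - s t₁ = 12 * h)
  step₂ : s t₂ % 6 = 5 ∧ s (t₂ + 1) - s t₂ = 6
  -- The link from `0` to `s 0` then realises the difference 12, which `even` leaves out.
  first : s 0 = 12
  even : ∀ d : ℤ, 3 ≤ d → d ≤ h → ∃ p, p + 1 < 4 * h ∧ p ≠ t₁ ∧ p ≠ t₂ ∧ s p % 6 = 0 ∧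
    (s (p + 1) - s p = 6 * d ∨ s p - s (p + 1) = 6 * d)
  odd : ∀ d : ℤ, 2 ≤ d → d ≤ h → ∃ p, p + 1 < 4 * h ∧ p ≠ t₁ ∧ p ≠ t₂ ∧ s p % 6 = 5 ∧
    (s (p + 1) - s p = 6 * d ∨ s p - s (p + 1) = 6 * d)
  mixed : ∀ d : ℤ, 1 ≤ d → d ≤ 2 * h → ∃ p, p + 1 < 4 * h ∧ p ≠ t₁ ∧ p ≠ t₂ ∧
    (s p % 6 = 0 ∧ (s (p + 1) - s p = 6 * d - 1 ∨ s (p + 1) - s p = 6 * d - 1 - (12 * h + 6)) ∨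
    s (p + 1) % 6 = 0 ∧
      (s p - s (p + 1) = 6 * d - 1 ∨ s p - s (p + 1) = 6 * d - 1 - (12 * h + 6)))

namespace FanPath

variable {h : ℕ} (P : FanPath h)

/-- The fan block obtained by cutting the path at the step `t`. -/
def block (t : ℕ) (ht : t + 1 < 4 * h) (e : ℤ × ℤ) : FanBlock h where
  s := P.s
  cut := t + 1
  cut_pos := by omega
  cut_lt := ht
  last := P.last
  mem_even := P.mem_even
  mem_odd := P.mem_odd
  extra := e

theorem linked_of_ne {t : ℕ} (ht : t + 1 < 4 * h) (e : ℤ × ℤ) {p : ℕ} (hp : p + 1 < 4 * h)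
    (hpt : p ≠ t) : (P.block t ht e).Linked (P.s p) (P.s (p + 1)) :=
  Or.inl ⟨p, hp, by simpa [block] using hpt, rfl, rfl⟩

/-- The second pole is placed in a marked step. That destroys only a difference 6 of one kind, and
the extra pair restores it. -/
theorem complete_block {t : ℕ} (ht : t + 1 < 4 * h) (htt : t = P.t₁ ∨ t = P.t₂) (e : ℤ × ℤ)
    (h₁ : t = P.t₁ → e.1 % 6 = 0 ∧ (e.2 - e.1 = 6 ∨ e.1 - e.2 = 6))
    (h₂ : t = P.t₂ → e.1 % 6 = 5 ∧ (e.2 - e.1 = 6 ∨ e.1 - e.2 = 6)) :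
    (P.block t ht e).Complete := by
  have hext : (P.block t ht e).Linked e.1 e.2 := Or.inr (Or.inr rfl)
  refine ⟨fun d hd hd' => ?_, fun d hd hd' => ?_, fun d hd hd' => ?_⟩
  · obtain rfl | rfl | h3 : d = 1 ∨ d = 2 ∨ 3 ≤ d := by omega
    · by_cases hc : t = P.t₁
      · obtain ⟨h3, h4 | h4⟩ := h₁ hc
        · exact ⟨_, _, Or.inl hext, h3, by omega⟩
        · exact ⟨_, _, Or.inr hext, by omega, by omega⟩
      · have hl := P.linked_of_ne ht e P.t₁_lt (Ne.symm hc)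
        obtain ⟨h3, h4 | h4⟩ := P.step₁
        · exact ⟨_, _, Or.inl hl, h3, by omega⟩
        · exact ⟨_, _, Or.inr hl, by omega, by omega⟩
    · have := P.first
      exact ⟨0, P.s 0, Or.inl (Or.inr (Or.inl ⟨rfl, rfl⟩)), rfl, by omega⟩
    · obtain ⟨p, hp, h4, h5, h6, h7⟩ := P.even d h3 hd'
      have hl := P.linked_of_ne ht e hp (t := t) (by rcases htt with rfl | rfl <;> assumption)
      rcases h7 with h7 | h7
      · exact ⟨_, _, Or.inl hl, h6, by omega⟩
      · exact ⟨_, _, Or.inr hl, by omega, by omega⟩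
  · obtain rfl | h3 : d = 1 ∨ 2 ≤ d := by omega
    · by_cases hc : t = P.t₂
      · obtain ⟨h3, h4 | h4⟩ := h₂ hc
        · exact ⟨_, _, Or.inl hext, h3, by omega⟩
        · exact ⟨_, _, Or.inr hext, by omega, by omega⟩
      · have hl := P.linked_of_ne ht e P.t₂_lt (Ne.symm hc)
        obtain ⟨h3, h4⟩ := P.step₂
        exact ⟨_, _, Or.inl hl, h3, by omega⟩
    · obtain ⟨p, hp, h4, h5, h6, h7⟩ := P.odd d h3 hd'
      have hl := P.linked_of_ne ht e hp (t := t) (by rcases htt with rfl | rfl <;> assumption)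
      rcases h7 with h7 | h7
      · exact ⟨_, _, Or.inl hl, h6, by omega⟩
      · exact ⟨_, _, Or.inr hl, by omega, by omega⟩
  · obtain ⟨p, hp, h4, h5, h6⟩ := P.mixed d hd hd'
    have hl := P.linked_of_ne ht e hp (t := t) (by rcases htt with rfl | rfl <;> assumption)
    rcases h6 with ⟨h6, h7⟩ | ⟨h6, h7⟩
    · exact ⟨_, _, Or.inl hl, h6, h7⟩
    · exact ⟨_, _, Or.inr hl, h6, h7⟩

end FanPath

/-- The fan system of a path and a middle block. -/
def FanSystem.ofBlocks {h : ℕ} (P : FanPath h) (B : FanBlock h) (hB : B.Complete) (y : ℕ)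
    (hy : 1 ≤ y) (hy' : y + 1 < 4 * h) (hs : B.s y = 5) (hc : y ≠ B.cut) (hc' : y + 1 ≠ B.cut)
    (he : B.extra = (B.s (y - 1), B.s (y + 1))) : FanSystem h where
  block g := if g = 0 then P.block P.t₁ P.t₁_lt (0, 6) else if g = 1 then B else
    P.block P.t₂ P.t₂_lt (-1, 5)
  complete g := by
    have hne : P.t₁ ≠ P.t₂ := fun hc => by
      have h1 := P.step₁.1
      have h2 := P.step₂.1
      rw [hc] at h1
      omega
    split_ifs
    · exact P.complete_block _ (Or.inl rfl) _ (fun _ => by simp) fun hc => absurd hc hne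
    · exact hB
    · exact P.complete_block _ (Or.inr rfl) _ (fun hc => absurd hc.symm hne) fun _ => by simp
  extra_zero := rfl
  extra_two := rfl
  flip := y
  flip_pos := hy
  flip_lt := hy'
  flip_label := hs
  flip_ne := hc
  flip_succ_ne := hc'
  extra_one := he

/-! ### Explicit zigzag sequences -/

/-- The labels of the path for `h = 2 * k`. -/
def evenSeq (k p : ℕ) : ℤ :=
  if p < 2 * k - 1 then (if p % 2 = 0 then 6 * (2 + (p / 2 : ℕ)) else -6 * ((p + 1) / 2 : ℕ))
  else if p < 4 * k - 2 then
    (if (p - (2 * k - 1)) % 2 = 0 then 6 * (k + 2 + ((p - (2 * k - 1)) / 2 : ℕ))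
    else 6 * (3 * k - ((p - (2 * k - 1)) / 2 : ℕ)) - 1)
  else if p < 6 * k - 2 then
    (if p % 2 = 0 then 6 * (-1 - ((p - (4 * k - 2)) / 2 : ℕ)) - 1
    else 6 * (1 + ((p - (4 * k - 2)) / 2 : ℕ)) - 1)
  else if p < 8 * k - 1 then
    (if p % 2 = 0 then 6 * (k + 1 + ((p - (6 * k - 2)) / 2 : ℕ)) - 1
    else 6 * (3 * k + 1 - ((p - (6 * k - 2)) / 2 : ℕ)))
  else 6

/-- The labels of the path for `h = 2 * k + 1`. -/
def oddSeq (k p : ℕ) : ℤ :=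
  if p < 2 * k then (if p % 2 = 0 then 6 * (2 + (p / 2 : ℕ)) else -6 * ((p + 1) / 2 : ℕ))
  else if p < 4 * k then
    (if p % 2 = 0 then 6 * (3 * k + 2 - ((p - 2 * k) / 2 : ℕ))
    else 6 * (3 * k + 3 + ((p - 2 * k) / 2 : ℕ)) - 1)
  else if p < 6 * k + 2 then
    (if p % 2 = 0 then 6 * (2 * k + 2 - ((p - 4 * k) / 2 : ℕ))
    else 6 * (1 + ((p - 4 * k) / 2 : ℕ)) - 1)
  else if p < 8 * k + 2 then
    (if p % 2 = 0 then 6 * (3 * k + 2 - ((p - (6 * k + 2)) / 2 : ℕ)) - 1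
    else 6 * (k + 2 + ((p - (6 * k + 2)) / 2 : ℕ)) - 1)
  else if p = 8 * k + 2 then 6 * (2 * k + 2) - 1
  else 6

theorem evenSeq_fst_even {k i : ℕ} (hi : 2 * i < 2 * k - 1) : evenSeq k (2 * i) = 6 * (2 + i) := by
  unfold evenSeq
  split_ifs <;> omega

theorem evenSeq_fst_odd {k i : ℕ} (hi : 2 * i + 1 < 2 * k - 1) :
    evenSeq k (2 * i + 1) = -6 * (i + 1) := by
  unfold evenSeq
  split_ifs <;> omega

theorem evenSeq_snd_even {k i : ℕ} (hi : 2 * i < 2 * k - 1) :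
    evenSeq k (2 * k - 1 + 2 * i) = 6 * (k + 2 + i) := by
  unfold evenSeq
  split_ifs <;> omega

theorem evenSeq_snd_odd {k i : ℕ} (hi : 2 * i + 1 < 2 * k - 1) :
    evenSeq k (2 * k + 2 * i) = 6 * (3 * k - i) - 1 := by
  unfold evenSeq
  split_ifs <;> omega

theorem evenSeq_trd_even {k i : ℕ} (hi : i < k) :
    evenSeq k (4 * k - 2 + 2 * i) = 6 * (-1 - i) - 1 := by
  unfold evenSeq
  split_ifs <;> omega

theorem evenSeq_trd_odd {k i : ℕ} (hi : i < k) :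
    evenSeq k (4 * k - 1 + 2 * i) = 6 * (1 + i) - 1 := by
  unfold evenSeq
  split_ifs <;> omega

theorem evenSeq_fth_even {k i : ℕ} (hi : 1 ≤ k ∧ i ≤ k) :
    evenSeq k (6 * k - 2 + 2 * i) = 6 * (k + 1 + i) - 1 := by
  unfold evenSeq
  split_ifs <;> omega

theorem evenSeq_fth_odd {k i : ℕ} (hi : i < k) :
    evenSeq k (6 * k - 1 + 2 * i) = 6 * (3 * k + 1 - i) := by
  unfold evenSeq
  split_ifs <;> omega

theorem evenSeq_last {k : ℕ} (hk : 1 ≤ k) : evenSeq k (8 * k - 1) = 6 := by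
  unfold evenSeq
  split_ifs <;> omega

theorem evenSeq_mem_even {k : ℕ} (hk : 1 ≤ k) (d : ℤ) (hd : 1 ≤ d)
    (hd' : d ≤ 2 * ((2 * k : ℕ) : ℤ)) :
    ∃ p < 4 * (2 * k), evenSeq k p = 6 * d ∨
      evenSeq k p = 6 * d - (12 * ((2 * k : ℕ) : ℤ) + 6) := by
  lift d to ℕ using by omega
  push_cast at hd'
  obtain h | h | h | h | h : (d = 1) ∨ (2 ≤ d ∧ d ≤ k + 1) ∨ (k + 2 ≤ d ∧ d ≤ 2 * k + 1) ∨
      (2 * k + 2 ≤ d ∧ d ≤ 3 * k + 1) ∨ (3 * k + 2 ≤ d) := by omega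
  · exact ⟨8 * k - 1, by omega, by rw [evenSeq_last hk]; omega⟩
  · refine ⟨2 * (d - 2), by omega, ?_⟩
    rw [evenSeq_fst_even (by omega)]
    omega
  · refine ⟨2 * k - 1 + 2 * (d - k - 2), by omega, ?_⟩
    rw [evenSeq_snd_even (by omega)]
    omega
  · refine ⟨6 * k - 1 + 2 * (3 * k + 1 - d), by omega, ?_⟩
    rw [evenSeq_fth_odd (by omega)]
    omega
  · refine ⟨2 * (4 * k - d) + 1, by omega, ?_⟩
    rw [evenSeq_fst_odd (by omega)]
    omega

theorem evenSeq_mem_odd {k : ℕ} (hk : 1 ≤ k) (d : ℤ) (hd : 1 ≤ d)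
    (hd' : d ≤ 2 * ((2 * k : ℕ) : ℤ)) :
    ∃ p < 4 * (2 * k), evenSeq k p = 6 * d - 1 ∨
      evenSeq k p = 6 * d - 1 - (12 * ((2 * k : ℕ) : ℤ) + 6) := by
  lift d to ℕ using by omega
  push_cast at hd'
  obtain h | h | h | h : (d ≤ k) ∨ (k + 1 ≤ d ∧ d ≤ 2 * k + 1) ∨ (2 * k + 2 ≤ d ∧ d ≤ 3 * k) ∨
      (3 * k + 1 ≤ d) := by omega
  · refine ⟨4 * k - 1 + 2 * (d - 1), by omega, ?_⟩
    rw [evenSeq_trd_odd (by omega)]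
    omega
  · refine ⟨6 * k - 2 + 2 * (d - k - 1), by omega, ?_⟩
    rw [evenSeq_fth_even (by omega)]
    omega
  · refine ⟨2 * k + 2 * (3 * k - d), by omega, ?_⟩
    rw [evenSeq_snd_odd (by omega)]
    omega
  · refine ⟨4 * k - 2 + 2 * (4 * k - d), by omega, ?_⟩
    rw [evenSeq_trd_even (by omega)]
    omega

/-- The first segment alternates between rising and falling labels, so its differences grow by 6 at
each step. -/
theorem evenSeq_even {k : ℕ} (hk : 1 ≤ k) (d : ℤ) (hd : 3 ≤ d) (hd' : d ≤ ((2 * k : ℕ) : ℤ)) :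
    ∃ p, p + 1 < 4 * (2 * k) ∧ p ≠ 2 * k - 2 ∧ p ≠ 6 * k - 3 ∧ evenSeq k p % 6 = 0 ∧
      (evenSeq k (p + 1) - evenSeq k p = 6 * d ∨ evenSeq k p - evenSeq k (p + 1) = 6 * d) := by
  lift d to ℕ using by omega
  push_cast at hd'
  obtain ⟨i, rfl | rfl⟩ : ∃ i, d = 2 * i + 3 ∨ d = 2 * i + 4 := ⟨(d - 3) / 2, by omega⟩
  · have e1 := evenSeq_fst_even (k := k) (i := i) (by omega)
    have e2 := evenSeq_fst_odd (k := k) (i := i) (by omega)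
    rw [show 2 * i + 1 = 2 * i + 1 by omega] at e2
    exact ⟨2 * i, by omega, by omega, by omega, by rw [e1]; omega,
      by rw [e1, e2]; omega⟩
  · have e1 := evenSeq_fst_odd (k := k) (i := i) (by omega)
    have e2 := evenSeq_fst_even (k := k) (i := i + 1) (by omega)
    rw [show 2 * (i + 1) = 2 * i + 1 + 1 by omega] at e2
    exact ⟨2 * i + 1, by omega, by omega, by omega, by rw [e1]; omega,
      by rw [e1, e2]; omega⟩

theorem evenSeq_odd {k : ℕ} (hk : 1 ≤ k) (d : ℤ) (hd : 2 ≤ d) (hd' : d ≤ ((2 * k : ℕ) : ℤ)) :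
    ∃ p, p + 1 < 4 * (2 * k) ∧ p ≠ 2 * k - 2 ∧ p ≠ 6 * k - 3 ∧ evenSeq k p % 6 = 5 ∧
      (evenSeq k (p + 1) - evenSeq k p = 6 * d ∨ evenSeq k p - evenSeq k (p + 1) = 6 * d) := by
  lift d to ℕ using by omega
  push_cast at hd'
  obtain ⟨i, rfl | rfl⟩ : ∃ i, d = 2 * i + 2 ∨ d = 2 * i + 3 := ⟨(d - 2) / 2, by omega⟩
  · have e1 := evenSeq_trd_even (k := k) (i := i) (by omega)
    have e2 := evenSeq_trd_odd (k := k) (i := i) (by omega)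
    rw [show 4 * k - 1 + 2 * i = 4 * k - 2 + 2 * i + 1 by omega] at e2
    exact ⟨4 * k - 2 + 2 * i, by omega, by omega, by omega, by rw [e1]; omega,
      by rw [e1, e2]; omega⟩
  · have e1 := evenSeq_trd_odd (k := k) (i := i) (by omega)
    have e2 := evenSeq_trd_even (k := k) (i := i + 1) (by omega)
    rw [show 4 * k - 2 + 2 * (i + 1) = 4 * k - 1 + 2 * i + 1 by omega] at e2
    exact ⟨4 * k - 1 + 2 * i, by omega, by omega, by omega, by rw [e1]; omega,
      by rw [e1, e2]; omega⟩

/-- The second segment gives d from 2k-2 down to 1 and the fourth gives d from 2k+1 up to 4k; the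
step into the third segment and the final step fill in 2k-1 and 2k. -/
theorem evenSeq_mixed {k : ℕ} (hk : 1 ≤ k) (d : ℤ) (hd : 1 ≤ d) (hd' : d ≤ 2 * ((2 * k : ℕ) : ℤ)) :
    ∃ p, p + 1 < 4 * (2 * k) ∧ p ≠ 2 * k - 2 ∧ p ≠ 6 * k - 3 ∧
      (evenSeq k p % 6 = 0 ∧ (evenSeq k (p + 1) - evenSeq k p = 6 * d - 1 ∨
        evenSeq k (p + 1) - evenSeq k p = 6 * d - 1 - (12 * ((2 * k : ℕ) : ℤ) + 6)) ∨
      evenSeq k (p + 1) % 6 = 0 ∧ (evenSeq k p - evenSeq k (p + 1) = 6 * d - 1 ∨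
        evenSeq k p - evenSeq k (p + 1) = 6 * d - 1 - (12 * ((2 * k : ℕ) : ℤ) + 6))) := by
  lift d to ℕ using by omega
  push_cast at hd'
  obtain h | h | h | h : d ≤ 2 * k - 2 ∨ d = 2 * k - 1 ∨ d = 2 * k ∨ 2 * k + 1 ≤ d := by omega
  · obtain ⟨i, hi | hi⟩ : ∃ i, 2 * k - 2 - d = 2 * i ∨ 2 * k - 2 - d = 2 * i + 1 :=
      ⟨(2 * k - 2 - d) / 2, by omega⟩
    · have e1 := evenSeq_snd_even (k := k) (i := i) (by omega)
      have e2 := evenSeq_snd_odd (k := k) (i := i) (by omega)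
      rw [show 2 * k + 2 * i = 2 * k - 1 + 2 * i + 1 by omega] at e2
      exact ⟨2 * k - 1 + 2 * i, by omega, by omega, by omega, by rw [e1, e2]; omega⟩
    · have e1 := evenSeq_snd_odd (k := k) (i := i) (by omega)
      have e2 := evenSeq_snd_even (k := k) (i := i + 1) (by omega)
      rw [show 2 * k - 1 + 2 * (i + 1) = 2 * k + 2 * i + 1 by omega] at e2
      exact ⟨2 * k + 2 * i, by omega, by omega, by omega, by rw [e1, e2]; omega⟩
  · have e1 := evenSeq_snd_even (k := k) (i := k - 1) (by omega)
    have e2 := evenSeq_trd_even (k := k) (i := 0) (by omega)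
    rw [show 4 * k - 2 + 2 * 0 = 2 * k - 1 + 2 * (k - 1) + 1 by omega] at e2
    exact ⟨2 * k - 1 + 2 * (k - 1), by omega, by omega, by omega, by rw [e1, e2]; omega⟩
  · have e1 := evenSeq_fth_even (k := k) (i := k) (by omega)
    have e2 := evenSeq_last hk
    rw [show 8 * k - 1 = 6 * k - 2 + 2 * k + 1 by omega] at e2
    exact ⟨6 * k - 2 + 2 * k, by omega, by omega, by omega, by rw [e1, e2]; omega⟩
  · obtain ⟨i, hi | hi⟩ : ∃ i, d = 2 * k + 1 + 2 * i ∨ d = 2 * k + 2 + 2 * i :=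
      ⟨(d - 2 * k - 1) / 2, by omega⟩
    · have e1 := evenSeq_fth_even (k := k) (i := i) (by omega)
      have e2 := evenSeq_fth_odd (k := k) (i := i) (by omega)
      rw [show 6 * k - 1 + 2 * i = 6 * k - 2 + 2 * i + 1 by omega] at e2
      exact ⟨6 * k - 2 + 2 * i, by omega, by omega, by omega, by rw [e1, e2]; omega⟩
    · have e1 := evenSeq_fth_odd (k := k) (i := i) (by omega)
      have e2 := evenSeq_fth_even (k := k) (i := i + 1) (by omega)
      rw [show 6 * k - 2 + 2 * (i + 1) = 6 * k - 1 + 2 * i + 1 by omega] at e2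
      exact ⟨6 * k - 1 + 2 * i, by omega, by omega, by omega, by rw [e1, e2]; omega⟩

/-- The path for `h = 2 * k`. -/
def evenPath (k : ℕ) (hk : 1 ≤ k) : FanPath (2 * k) where
  s := evenSeq k
  t₁ := 2 * k - 2
  t₂ := 6 * k - 3
  t₁_lt := by omega
  t₂_lt := by omega
  last := by unfold evenSeq; split_ifs <;> omega
  mem_even := evenSeq_mem_even hk
  mem_odd := evenSeq_mem_odd hk
  step₁ := by
    have h1 : evenSeq k (2 * k - 2) = 6 * (k + 1) := by unfold evenSeq; split_ifs <;> omega
    have h2 : evenSeq k (2 * k - 2 + 1) = 6 * (k + 2) := by unfold evenSeq; split_ifs <;> omega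
    rw [h1, h2]
    omega
  step₂ := by
    have h1 : evenSeq k (6 * k - 3) = 6 * k - 1 := by unfold evenSeq; split_ifs <;> omega
    have h2 : evenSeq k (6 * k - 3 + 1) = 6 * (k + 1) - 1 := by unfold evenSeq; split_ifs <;> omega
    rw [h1, h2]
    omega
  first := by unfold evenSeq; split_ifs <;> omega
  even := evenSeq_even hk
  odd := evenSeq_odd hk
  mixed := evenSeq_mixed hk

theorem oddSeq_fst_even {k i : ℕ} (hi : i < k) : oddSeq k (2 * i) = 6 * (2 + i) := by
  unfold oddSeq
  split_ifs <;> omega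

theorem oddSeq_fst_odd {k i : ℕ} (hi : i < k) : oddSeq k (2 * i + 1) = -6 * (i + 1) := by
  unfold oddSeq
  split_ifs <;> omega

theorem oddSeq_snd_even {k i : ℕ} (hi : i < k) :
    oddSeq k (2 * k + 2 * i) = 6 * (3 * k + 2 - i) := by
  unfold oddSeq
  split_ifs <;> omega

theorem oddSeq_snd_odd {k i : ℕ} (hi : i < k) :
    oddSeq k (2 * k + 1 + 2 * i) = 6 * (3 * k + 3 + i) - 1 := by
  unfold oddSeq
  split_ifs <;> omega

theorem oddSeq_trd_even {k i : ℕ} (hi : i ≤ k) :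
    oddSeq k (4 * k + 2 * i) = 6 * (2 * k + 2 - i) := by
  unfold oddSeq
  split_ifs <;> omega

theorem oddSeq_trd_odd {k i : ℕ} (hi : i ≤ k) : oddSeq k (4 * k + 1 + 2 * i) = 6 * (1 + i) - 1 := by
  unfold oddSeq
  split_ifs <;> omega

theorem oddSeq_fth_even {k i : ℕ} (hi : i < k) :
    oddSeq k (6 * k + 2 + 2 * i) = 6 * (3 * k + 2 - i) - 1 := by
  unfold oddSeq
  split_ifs <;> omega

theorem oddSeq_fth_odd {k i : ℕ} (hi : i < k) :
    oddSeq k (6 * k + 3 + 2 * i) = 6 * (k + 2 + i) - 1 := by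
  unfold oddSeq
  split_ifs <;> omega

theorem oddSeq_penultimate (k : ℕ) : oddSeq k (8 * k + 2) = 6 * (2 * k + 2) - 1 := by
  unfold oddSeq
  split_ifs <;> omega

theorem oddSeq_last (k : ℕ) : oddSeq k (8 * k + 3) = 6 := by
  unfold oddSeq
  split_ifs <;> omega

theorem oddSeq_mem_even {k : ℕ} (d : ℤ) (hd : 1 ≤ d) (hd' : d ≤ 2 * ((2 * k + 1 : ℕ) : ℤ)) :
    ∃ p < 4 * (2 * k + 1), oddSeq k p = 6 * d ∨
      oddSeq k p = 6 * d - (12 * ((2 * k + 1 : ℕ) : ℤ) + 6) := by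
  lift d to ℕ using by omega
  push_cast at hd'
  obtain h | h | h | h | h : (d = 1) ∨ (2 ≤ d ∧ d ≤ k + 1) ∨ (k + 2 ≤ d ∧ d ≤ 2 * k + 2) ∨
      (2 * k + 3 ≤ d ∧ d ≤ 3 * k + 2) ∨ (3 * k + 3 ≤ d) := by omega
  · exact ⟨8 * k + 3, by omega, by rw [oddSeq_last]; omega⟩
  · refine ⟨2 * (d - 2), by omega, ?_⟩
    rw [oddSeq_fst_even (by omega)]
    omega
  · refine ⟨4 * k + 2 * (2 * k + 2 - d), by omega, ?_⟩
    rw [oddSeq_trd_even (by omega)]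
    omega
  · refine ⟨2 * k + 2 * (3 * k + 2 - d), by omega, ?_⟩
    rw [oddSeq_snd_even (by omega)]
    omega
  · refine ⟨2 * (4 * k + 2 - d) + 1, by omega, ?_⟩
    rw [oddSeq_fst_odd (by omega)]
    omega

theorem oddSeq_mem_odd {k : ℕ} (d : ℤ) (hd : 1 ≤ d) (hd' : d ≤ 2 * ((2 * k + 1 : ℕ) : ℤ)) :
    ∃ p < 4 * (2 * k + 1), oddSeq k p = 6 * d - 1 ∨
      oddSeq k p = 6 * d - 1 - (12 * ((2 * k + 1 : ℕ) : ℤ) + 6) := by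
  lift d to ℕ using by omega
  push_cast at hd'
  obtain h | h | h | h | h : (d ≤ k + 1) ∨ (k + 2 ≤ d ∧ d ≤ 2 * k + 1) ∨ (d = 2 * k + 2) ∨
      (2 * k + 3 ≤ d ∧ d ≤ 3 * k + 2) ∨ (3 * k + 3 ≤ d) := by omega
  · refine ⟨4 * k + 1 + 2 * (d - 1), by omega, ?_⟩
    rw [oddSeq_trd_odd (by omega)]
    omega
  · refine ⟨6 * k + 3 + 2 * (d - k - 2), by omega, ?_⟩
    rw [oddSeq_fth_odd (by omega)]
    omega
  · exact ⟨8 * k + 2, by omega, by rw [oddSeq_penultimate]; omega⟩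
  · refine ⟨6 * k + 2 + 2 * (3 * k + 2 - d), by omega, ?_⟩
    rw [oddSeq_fth_even (by omega)]
    omega
  · refine ⟨2 * k + 1 + 2 * (d - 3 * k - 3), by omega, ?_⟩
    rw [oddSeq_snd_odd (by omega)]
    omega

theorem oddSeq_even {k : ℕ} (hk : 1 ≤ k) (d : ℤ) (hd : 3 ≤ d) (hd' : d ≤ ((2 * k + 1 : ℕ) : ℤ)) :
    ∃ p, p + 1 < 4 * (2 * k + 1) ∧ p ≠ 2 * k - 1 ∧ p ≠ 8 * k + 1 ∧ oddSeq k p % 6 = 0 ∧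
      (oddSeq k (p + 1) - oddSeq k p = 6 * d ∨ oddSeq k p - oddSeq k (p + 1) = 6 * d) := by
  lift d to ℕ using by omega
  push_cast at hd'
  obtain ⟨i, rfl | rfl⟩ : ∃ i, d = 2 * i + 3 ∨ d = 2 * i + 4 := ⟨(d - 3) / 2, by omega⟩
  · have e1 := oddSeq_fst_even (k := k) (i := i) (by omega)
    have e2 := oddSeq_fst_odd (k := k) (i := i) (by omega)
    rw [show 2 * i + 1 = 2 * i + 1 by omega] at e2
    exact ⟨2 * i, by omega, by omega, by omega, by rw [e1]; omega,
      by rw [e1, e2]; omega⟩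
  · have e1 := oddSeq_fst_odd (k := k) (i := i) (by omega)
    have e2 := oddSeq_fst_even (k := k) (i := i + 1) (by omega)
    rw [show 2 * (i + 1) = 2 * i + 1 + 1 by omega] at e2
    exact ⟨2 * i + 1, by omega, by omega, by omega, by rw [e1]; omega,
      by rw [e1, e2]; omega⟩

/-- The fourth segment converges, giving d from 2k down to 2; the step leading into it gives 2k+1.
-/
theorem oddSeq_odd {k : ℕ} (hk : 1 ≤ k) (d : ℤ) (hd : 2 ≤ d) (hd' : d ≤ ((2 * k + 1 : ℕ) : ℤ)) :
    ∃ p, p + 1 < 4 * (2 * k + 1) ∧ p ≠ 2 * k - 1 ∧ p ≠ 8 * k + 1 ∧ oddSeq k p % 6 = 5 ∧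
      (oddSeq k (p + 1) - oddSeq k p = 6 * d ∨ oddSeq k p - oddSeq k (p + 1) = 6 * d) := by
  lift d to ℕ using by omega
  push_cast at hd'
  obtain h | ⟨i, h | h⟩ : d = 2 * k + 1 ∨ ∃ i, 2 * k = d + 2 * i ∨ 2 * k = d + 2 * i + 1 := by
    rcases hd'.lt_or_eq with h | h
    · exact Or.inr ⟨(2 * k - d) / 2, by omega⟩
    · exact Or.inl (by omega)
  · have e1 := oddSeq_trd_odd (k := k) (i := k) (by omega)
    have e2 := oddSeq_fth_even (k := k) (i := 0) (by omega)
    rw [show 6 * k + 2 + 2 * 0 = 4 * k + 1 + 2 * k + 1 by omega] at e2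
    exact ⟨4 * k + 1 + 2 * k, by omega, by omega, by omega, by rw [e1]; omega,
      by rw [e1, e2]; omega⟩
  · have e1 := oddSeq_fth_even (k := k) (i := i) (by omega)
    have e2 := oddSeq_fth_odd (k := k) (i := i) (by omega)
    rw [show 6 * k + 3 + 2 * i = 6 * k + 2 + 2 * i + 1 by omega] at e2
    exact ⟨6 * k + 2 + 2 * i, by omega, by omega, by omega, by rw [e1]; omega,
      by rw [e1, e2]; omega⟩
  · have e1 := oddSeq_fth_odd (k := k) (i := i) (by omega)
    have e2 := oddSeq_fth_even (k := k) (i := i + 1) (by omega)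
    rw [show 6 * k + 2 + 2 * (i + 1) = 6 * k + 3 + 2 * i + 1 by omega] at e2
    exact ⟨6 * k + 3 + 2 * i, by omega, by omega, by omega, by rw [e1]; omega,
      by rw [e1, e2]; omega⟩

/-- The second segment gives d up to 2k-1, the step after it 2k, the third segment 2k+2 up to 4k+2,
and the final step 2k+1. -/
theorem oddSeq_mixed {k : ℕ} (hk : 1 ≤ k) (d : ℤ) (hd : 1 ≤ d)
    (hd' : d ≤ 2 * ((2 * k + 1 : ℕ) : ℤ)) :
    ∃ p, p + 1 < 4 * (2 * k + 1) ∧ p ≠ 2 * k - 1 ∧ p ≠ 8 * k + 1 ∧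
      (oddSeq k p % 6 = 0 ∧ (oddSeq k (p + 1) - oddSeq k p = 6 * d - 1 ∨
        oddSeq k (p + 1) - oddSeq k p = 6 * d - 1 - (12 * ((2 * k + 1 : ℕ) : ℤ) + 6)) ∨
      oddSeq k (p + 1) % 6 = 0 ∧ (oddSeq k p - oddSeq k (p + 1) = 6 * d - 1 ∨
        oddSeq k p - oddSeq k (p + 1) = 6 * d - 1 - (12 * ((2 * k + 1 : ℕ) : ℤ) + 6))) := by
  lift d to ℕ using by omega
  push_cast at hd'
  obtain h | h | h | h : d < 2 * k ∨ d = 2 * k ∨ d = 2 * k + 1 ∨ 2 * k + 2 ≤ d := by omega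
  · obtain ⟨i, rfl | rfl⟩ : ∃ i, d = 2 * i + 1 ∨ d = 2 * i + 2 := ⟨(d - 1) / 2, by omega⟩
    · have e1 := oddSeq_snd_even (k := k) (i := i) (by omega)
      have e2 := oddSeq_snd_odd (k := k) (i := i) (by omega)
      rw [show 2 * k + 1 + 2 * i = 2 * k + 2 * i + 1 by omega] at e2
      exact ⟨2 * k + 2 * i, by omega, by omega, by omega, by rw [e1, e2]; omega⟩
    · have e1 := oddSeq_snd_odd (k := k) (i := i) (by omega)
      have e2 := oddSeq_snd_even (k := k) (i := i + 1) (by omega)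
      rw [show 2 * k + 2 * (i + 1) = 2 * k + 1 + 2 * i + 1 by omega] at e2
      exact ⟨2 * k + 1 + 2 * i, by omega, by omega, by omega, by rw [e1, e2]; omega⟩
  · have e1 := oddSeq_snd_odd (k := k) (i := k - 1) (by omega)
    have e2 := oddSeq_trd_even (k := k) (i := 0) (by omega)
    rw [show 4 * k + 2 * 0 = 2 * k + 1 + 2 * (k - 1) + 1 by omega] at e2
    exact ⟨2 * k + 1 + 2 * (k - 1), by omega, by omega, by omega, by rw [e1, e2]; omega⟩
  · have e1 := oddSeq_penultimate k
    have e2 := oddSeq_last k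
    exact ⟨8 * k + 2, by omega, by omega, by omega, by rw [e1, e2]; omega⟩
  · obtain ⟨i, hi | hi⟩ : ∃ i, d = 2 * k + 2 + 2 * i ∨ d = 2 * k + 3 + 2 * i :=
      ⟨(d - 2 * k - 2) / 2, by omega⟩
    · have e1 := oddSeq_trd_even (k := k) (i := i) (by omega)
      have e2 := oddSeq_trd_odd (k := k) (i := i) (by omega)
      rw [show 4 * k + 1 + 2 * i = 4 * k + 2 * i + 1 by omega] at e2
      exact ⟨4 * k + 2 * i, by omega, by omega, by omega, by rw [e1, e2]; omega⟩
    · have e1 := oddSeq_trd_odd (k := k) (i := i) (by omega)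
      have e2 := oddSeq_trd_even (k := k) (i := i + 1) (by omega)
      rw [show 4 * k + 2 * (i + 1) = 4 * k + 1 + 2 * i + 1 by omega] at e2
      exact ⟨4 * k + 1 + 2 * i, by omega, by omega, by omega, by rw [e1, e2]; omega⟩

/-- The path for `h = 2 * k + 1`. -/
def oddPath (k : ℕ) (hk : 1 ≤ k) : FanPath (2 * k + 1) where
  s := oddSeq k
  t₁ := 2 * k - 1
  t₂ := 8 * k + 1
  t₁_lt := by omega
  t₂_lt := by omega
  last := by unfold oddSeq; split_ifs <;> omega
  mem_even := oddSeq_mem_even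
  mem_odd := oddSeq_mem_odd
  step₁ := by
    have h1 : oddSeq k (2 * k - 1) = -6 * k := by unfold oddSeq; split_ifs <;> omega
    have h2 : oddSeq k (2 * k - 1 + 1) = 6 * (3 * k + 2) := by unfold oddSeq; split_ifs <;> omega
    rw [h1, h2]
    omega
  step₂ := by
    have h1 : oddSeq k (8 * k + 1) = 6 * (2 * k + 1) - 1 := by unfold oddSeq; split_ifs <;> omega
    have h2 : oddSeq k (8 * k + 1 + 1) = 6 * (2 * k + 2) - 1 := by
      unfold oddSeq; split_ifs <;> omega
    rw [h1, h2]
    omega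
  first := by unfold oddSeq; split_ifs <;> omega
  even := oddSeq_even hk
  odd := oddSeq_odd hk
  mixed := oddSeq_mixed hk

/-! ### Middle blocks and conclusion -/

/-- The middle block for `h = 2`. -/
def smallBlock : FanBlock 2 where
  s p := [12, 18, 23, 17, 5, 24, 11, 6].getD p 0
  cut := 2
  cut_pos := by omega
  cut_lt := by omega
  last := rfl
  mem_even d hd hd' := by
    obtain rfl | rfl | rfl | rfl : d = 1 ∨ d = 2 ∨ d = 3 ∨ d = 4 := by omega
    · exact ⟨7, by omega, Or.inl rfl⟩
    · exact ⟨0, by omega, Or.inl rfl⟩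
    · exact ⟨1, by omega, Or.inl rfl⟩
    · exact ⟨5, by omega, Or.inl rfl⟩
  mem_odd d hd hd' := by
    obtain rfl | rfl | rfl | rfl : d = 1 ∨ d = 2 ∨ d = 3 ∨ d = 4 := by omega
    · exact ⟨4, by omega, Or.inl rfl⟩
    · exact ⟨6, by omega, Or.inl rfl⟩
    · exact ⟨3, by omega, Or.inl rfl⟩
    · exact ⟨2, by omega, Or.inl rfl⟩
  -- The neighbours of the label 5; modulo 30 this pair supplies the mixed difference with d = 4.
  extra := (17, 24)

theorem complete_smallBlock : smallBlock.Complete where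
  even d hd hd' := by
    obtain rfl | rfl : d = 1 ∨ d = 2 := by omega
    · exact ⟨12, 18, Or.inl (Or.inl ⟨0, by omega, by decide, rfl, rfl⟩), by omega, by omega⟩
    · exact ⟨0, 12, Or.inl (Or.inr (Or.inl ⟨rfl, rfl⟩)), by omega, by omega⟩
  odd d hd hd' := by
    obtain rfl | rfl : d = 1 ∨ d = 2 := by omega
    · exact ⟨17, 23, Or.inr (Or.inl ⟨2, by omega, by decide, rfl, rfl⟩), by omega, by omega⟩
    · exact ⟨5, 17, Or.inr (Or.inl ⟨3, by omega, by decide, rfl, rfl⟩), by omega, by omega⟩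
  mixed d hd hd' := by
    obtain rfl | rfl | rfl | rfl : d = 1 ∨ d = 2 ∨ d = 3 ∨ d = 4 := by omega
    · exact ⟨6, 11, Or.inr (Or.inl ⟨6, by omega, by decide, rfl, rfl⟩), by omega, by omega⟩
    · exact ⟨24, 5, Or.inr (Or.inl ⟨4, by omega, by decide, rfl, rfl⟩), by omega, by omega⟩
    · exact ⟨24, 11, Or.inl (Or.inl ⟨5, by omega, by decide, rfl, rfl⟩), by omega, by omega⟩
    · exact ⟨24, 17, Or.inr (Or.inr (Or.inr rfl)), by omega, by omega⟩

/-- The bypassed label 5 lies between -7 and -13, so the bypass has difference 6 and the middle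
block is cut at `t₂`. For k = 1 that cut falls directly after the label 5, and `smallBlock` is used
instead. -/
theorem nonempty_fanSystem_even (k : ℕ) (hk : 1 ≤ k) : Nonempty (FanSystem (2 * k)) := by
  obtain rfl | hk2 : k = 1 ∨ 2 ≤ k := by omega
  · exact ⟨.ofBlocks (evenPath 1 le_rfl) smallBlock complete_smallBlock 4 (by omega) (by omega) rfl
      (by decide) (by decide) rfl⟩
  · have e0 := evenSeq_trd_even (k := k) (i := 0) (by omega)
    have e1 := evenSeq_trd_odd (k := k) (i := 0) (by omega)
    have e2 := evenSeq_trd_even (k := k) (i := 1) (by omega)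
    rw [show 4 * k - 2 + 2 * 0 = 4 * k - 1 - 1 by omega] at e0
    rw [show 4 * k - 1 + 2 * 0 = 4 * k - 1 by omega] at e1
    rw [show 4 * k - 2 + 2 * 1 = 4 * k - 1 + 1 by omega] at e2
    let P := evenPath k hk
    refine ⟨.ofBlocks P (P.block P.t₂ P.t₂_lt (P.s (4 * k - 1 - 1), P.s (4 * k - 1 + 1)))
      (P.complete_block _ (Or.inr rfl) _ ?_ ?_) (4 * k - 1) (by omega) (by omega) e1 ?_ ?_ rfl⟩
    · intro hc
      change 6 * k - 3 = 2 * k - 2 at hc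
      omega
    · intro _
      change evenSeq k (4 * k - 1 - 1) % 6 = 5 ∧
        (evenSeq k (4 * k - 1 + 1) - evenSeq k (4 * k - 1 - 1) = 6 ∨
          evenSeq k (4 * k - 1 - 1) - evenSeq k (4 * k - 1 + 1) = 6)
      rw [e0, e2]
      decide
    · change 4 * k - 1 ≠ 6 * k - 3 + 1
      omega
    · change 4 * k - 1 + 1 ≠ 6 * k - 3 + 1
      omega

/-- Here the label 5 lies between `6(2k+2)` and `6(2k+1)`, so the bypass replaces the marked step
`t₁`. -/
theorem nonempty_fanSystem_odd (k : ℕ) (hk : 1 ≤ k) : Nonempty (FanSystem (2 * k + 1)) := by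
  have e0 := oddSeq_trd_even (k := k) (i := 0) (by omega)
  have e1 := oddSeq_trd_odd (k := k) (i := 0) (by omega)
  have e2 := oddSeq_trd_even (k := k) (i := 1) (by omega)
  let P := oddPath k hk
  refine ⟨.ofBlocks P (P.block P.t₁ P.t₁_lt (P.s (4 * k + 1 - 1), P.s (4 * k + 1 + 1)))
    (P.complete_block _ (Or.inl rfl) _ ?_ ?_) (4 * k + 1) (by omega) (by omega) e1 ?_ ?_ rfl⟩
  · intro _
    change oddSeq k (4 * k) % 6 = 0 ∧ (oddSeq k (4 * k + 2) - oddSeq k (4 * k) = 6 ∨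
      oddSeq k (4 * k) - oddSeq k (4 * k + 2) = 6)
    rw [mul_zero, add_zero] at e0
    rw [mul_one] at e2
    rw [e0, e2]
    omega
  · intro hc
    change 2 * k - 1 = 8 * k + 1 at hc
    omega
  · change 4 * k + 1 ≠ 2 * k - 1 + 1
    omega
  · change 4 * k + 1 + 1 ≠ 2 * k - 1 + 1
    omega

theorem mainTheorem3 (m : ℕ) (hodd : Odd m) (hm : 5 ≤ m) :
    ∃ (V A : Type) (G : SimpleGraph V) (h : V → A), IsJGraph (6 * m) m G h ∧ IsPlanar G := by
  obtain ⟨h, rfl⟩ := hodd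
  have hS : Nonempty (FanSystem h) := by
    obtain ⟨k, rfl | rfl⟩ : ∃ k, h = 2 * k ∨ h = 2 * k + 1 := ⟨h / 2, by omega⟩
    · exact nonempty_fanSystem_even k (by omega)
    · exact nonempty_fanSystem_odd k (by omega)
  obtain ⟨S⟩ := hS
  exact ⟨_, _, S.graph, S.empire, S.isJGraph, S.isPlanar_graph (by omega)⟩
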